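/- Let $N_0$ be a positive integer and let $\{\widetilde A^{(N)}\in\mathbb R^{M_N\times N}\}_{N\ge N_0}$ be a sequence of random matrices with $\lim_{N\to\infty}M_N=\infty$, and put $A^{(N)}=\mathbb E[\widetilde A^{(N)}]$. For each $N\ge N_0$ let $\mathbf r^{(N)}\in\mathbb R^{M_N}$ and $\mathbf c^{(N)}\in\mathbb R^{N}$ be vectors with positive entries and $\|\mathbf r^{(N)}\|_1=\|\mathbf c^{(N)}\|_1=:s^{(N)}$. Suppose that for each $N\ge N_0$ the entries of $\widetilde A^{(N)}$ are (jointly) independent, and that there are positive constants $a,b$, independent of $N$, such that $\widetilde A^{(N)}_{i,j}\in[a,b]$ almost surely for all $N\ge N_0$, $i\in[M_N]$, $j\in[N]$. A pair of vectors $(\mathbf x,\mathbf y)$ with positive entries scales a matrix $B$ to row sums $\mathbf r$ and column sums $\mathbf c$ if $\sum_j x_iB_{i,j}y_j=r_i$ for all $i$ and $\sum_i x_iB_{i,j}y_j=c_j$ for all $j$; the matrix $D(\mathbf x)BD(\mathbf y)$ is then the scaled matrix, where $D(\mathbf v)$ is the diagonal matrix with diagonal $\mathbf v$. For each $N\ge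 N_0$ let $P^{(N)}$ and $\widetilde P^{(N)}$ be the matrices obtained from $A^{(N)}$ and $\widetilde A^{(N)}$, respectively, by scaling them to row sums $\mathbf r^{(N)}$ and column sums $\mathbf c^{(N)}$; these exist and are unique (for $\widetilde P^{(N)}$, almost surely). Define $$\rho_1^{(N)}=\max\left\{\frac{\|\mathbf r^{(N)}\|_2}{s^{(N)}},\frac{\|\mathbf c^{(N)}\|_2}{s^{(N)}}\right\},\qquad \rho_2^{(N)}=\max\left\{\frac{s^{(N)}}{M_N\min_i r_i^{(N)}},\frac{s^{(N)}}{N\min_j c_j^{(N)}}\right\},$$ $$\rho_3^{(N)}=\frac{\sqrt{M_N}\,\max_i r_i^{(N)}\cdot\sqrt N\,\max_j c_j^{(N)}}{s^{(N)}},$$ and, for random variables $X_N$ and a deterministic sequence $\gamma_N$, write $X_N=\mathcal O_{\mathrm{w.h.p.}}(\gamma_N)$ if there is a constant $C$ with $\lim_{N\to\infty}\Pr\{X_N\le C\gamma_N\}=1$. Then, in the operator norm $\|\cdot\|_2$ induced by the Euclidean norms, $$\|\widetilde P^{(N)}-P^{(N)}\|_2=\mathcal O_{\mathrm{w.h.p.}}\left(\rho_1^{(N)}\rho_2^{(N)}\rho_3^{(N)}\sqrt{\log(\max\{M_N,N\})}\right).$$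 In particular, in the doubly-stochastic case, where $M_N=N$ and $r_i^{(N)}=c_j^{(N)}=1$ for all $N\ge N_0$ and all $i,j$, one has $\|\widetilde P^{(N)}-P^{(N)}\|_2=\mathcal O_{\mathrm{w.h.p.}}\left(\sqrt{\log N/N}\right)$. -/

import Mathlib

namespace MatrixScaling

noncomputable section

open MeasureTheory Filter Topology

variable {m n : ℕ}

/-- The pair of positive vectors `(x, y)` scales `A` to row sums `r` and column sums `c`. -/
def Scales (A : Matrix (Fin m) (Fin n) ℝ) (r : Fin m → ℝ) (c : Fin n → ℝ)
    (x : Fin m → ℝ) (y : Fin n → ℝ) : Prop :=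
  (∀ i, 0 < x i) ∧ (∀ j, 0 < y j) ∧
    (∀ i, ∑ j, x i * A i j * y j = r i) ∧ (∀ j, ∑ i, x i * A i j * y j = c j)

/-- `P = D(x) A D(y)` for some pair of positive vectors `(x, y)` that scales `A` to row sums `r`
and column sums `c`. -/
def IsScaledMatrix (A : Matrix (Fin m) (Fin n) ℝ) (r : Fin m → ℝ) (c : Fin n → ℝ)
    (P : Matrix (Fin m) (Fin n) ℝ) : Prop :=
  ∃ x y, Scales A r c x y ∧ P = Matrix.diagonal x * A * Matrix.diagonal y

open Classical in
/-- The matrix obtained from `A` by scaling it to row sums `r` and column sums `c`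
(the zero matrix if `A` cannot be scaled in this way). -/
def scaledMatrix (A : Matrix (Fin m) (Fin n) ℝ) (r : Fin m → ℝ) (c : Fin n → ℝ) :
    Matrix (Fin m) (Fin n) ℝ :=
  if h : ∃ P, IsScaledMatrix A r c P then h.choose else 0

/-- The entrywise expectation of a random matrix. -/
def expectedMatrix {Ω : Type*} [MeasurableSpace Ω] (μ : Measure Ω)
    (A : Ω → Matrix (Fin m) (Fin n) ℝ) : Matrix (Fin m) (Fin n) ℝ :=
  Matrix.of fun i j => ∫ ω, A ω i j ∂μ

section

open scoped Matrix.Norms.L2Operator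

/-- The operator norm of a matrix with respect to the Euclidean norms. -/
def opNorm (B : Matrix (Fin m) (Fin n) ℝ) : ℝ := ‖B‖

end

/-- The Euclidean norm of a vector. -/
def norm2 (v : Fin m → ℝ) : ℝ := ‖WithLp.toLp 2 v‖

/-- `ρ₁ = max {‖r‖₂ / s, ‖c‖₂ / s}`, where `s` is the common `ℓ¹` norm of the positive vectors
`r` and `c`. -/
def rho1 (r : Fin m → ℝ) (c : Fin n → ℝ) : ℝ :=
  max (norm2 r / ∑ i, r i) (norm2 c / ∑ j, c j)

/-- `ρ₂ = max {s / (M min r), s / (N min c)}`. -/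
def rho2 (r : Fin m → ℝ) (c : Fin n → ℝ) : ℝ :=
  max ((∑ i, r i) / (m * ⨅ i, r i)) ((∑ j, c j) / (n * ⨅ j, c j))

/-- `ρ₃ = √M max r · √N max c / s`. -/
def rho3 (r : Fin m → ℝ) (c : Fin n → ℝ) : ℝ :=
  (√m * (⨆ i, r i)) * (√n * ⨆ j, c j) / ∑ i, r i

/-- `X_N = O_whp(γ_N)`: for some constant `C`, the probability of `X_N ≤ C γ_N` tends to `1`. -/
def IsBigOWhp {Ω : ℕ → Type*} [∀ N, MeasurableSpace (Ω N)] (μ : ∀ N, Measure (Ω N))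
    (X : ∀ N, Ω N → ℝ) (γ : ℕ → ℝ) : Prop :=
  ∃ C : ℝ, Tendsto (fun N => μ N {ω | X N ω ≤ C * γ N}) atTop (𝓝 1)

end

end MatrixScaling

namespace MatrixScaling

open Finset

variable {m n : ℕ}

/-! Scaling is stable. Suppose factors `(x, y)` give a matrix with entries in `[a, b]` the right row
and column sums up to relative error `ε`, and `(x', y')` gives them exactly. The quotients `u = x' /
x` and `v = y' / y` determine each other: up to a factor `1 ± ε`, each `u i` is the reciprocal of an
average of `v`, and conversely. The averaging weights of different rows are comparable, so each
averaging contracts the spread by `1 - a / b`. The spread therefore satisfies an inequality that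
forces it to be of order `ε * b / a`, and `x' i * y' j` is within relative error `O(ε)` of `x i * y
j` (`Scales.abs_mul_sub_mul_le`).

Let `(x, y)` scale the expectation. Hoeffding's inequality bounds the row and column errors on the
random matrix, giving `ε` of order `ρ₁ √log`. The difference of the scaled matrices is then a term
from the change of factors, dominated entrywise by a multiple of the rank-one matrix `r i * c j`,
plus the centered matrix multiplied by the fixed factors, whose operator norm is controlled by a net
argument. `Scales.opNorm_sub_le` combines these deterministically;
`measureReal_opNorm_scaledMatrix_sub_le` adds the probabilities. -/

/-! ### Stability of matrix scaling. -/

/-- Averages against weights with a uniform lower bound contract the ratio of the largest to the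
smallest value. -/
lemma weighted_average_ratio_le {a b T : ℝ} (ha : 0 < a) (hT : 0 ≤ T)
    {A : Matrix (Fin m) (Fin n) ℝ} (hA : ∀ i j, A i j ∈ Set.Icc a b)
    {y v : Fin n → ℝ} (hy : ∀ j, 0 < y j) (hv : ∀ j, 0 < v j)
    (hvT : ∀ j k, v j ≤ (1 + T) * v k) (i k : Fin m) :
    (∑ j, A i j * y j * v j) * ∑ j, A k j * y j ≤
      (1 + (1 - a / b) * T) * ((∑ j, A k j * y j * v j) * ∑ j, A i j * y j) := by
  rcases isEmpty_or_nonempty (Fin n) with hn | hn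
  · simp
  obtain ⟨j₀, hj₀⟩ := Finite.exists_min v
  have hb : 0 < b := ha.trans_le ((hA i j₀).1.trans (hA i j₀).2)
  set δ := a / b with hδ
  have hδb : δ * b = a := by rw [hδ]; field_simp
  have hδ0 : 0 < δ := div_pos ha hb
  have hδ1 : δ ≤ 1 := (div_le_one hb).2 ((hA i j₀).1.trans (hA i j₀).2)
  set l := v j₀
  have hl : 0 < l := hv j₀
  set Y := ∑ j, y j
  have hY : 0 < Y := sum_pos (fun j _ => hy j) univ_nonempty
  set V := ∑ j, y j * v j
  have hVl : l * Y ≤ V := by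
    simp only [Y, V, mul_sum]
    exact sum_le_sum fun j _ => by nlinarith [hy j, hj₀ j]
  have hpos : ∀ i, 0 < ∑ j, A i j * y j := fun i =>
    sum_pos (fun j _ => mul_pos (ha.trans_le (hA i j).1) (hy j)) univ_nonempty
  have hrow : ∀ i, ∑ j, A i j * y j ≤ b * Y := fun i => by
    simp only [Y, mul_sum]
    exact sum_le_sum fun j _ => mul_le_mul_of_nonneg_right (hA i j).2 (hy j).le
  set μ := V / Y with hμ
  have hμY : μ * Y = V := by rw [hμ]; field_simp
  have hμl : l ≤ μ := by rw [hμ, le_div_iff₀ hY]; exact hVl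
  have hμu : μ ≤ (1 + T) * l := by
    rw [hμ, div_le_iff₀ hY]
    simp only [Y, V, mul_sum]
    exact sum_le_sum fun j _ => by nlinarith [hy j, hvT j j₀]
  -- Doeblin minorization: the normalized weights of every row dominate `δ * y j / Y`. So each row
  -- average is `δ * μ` plus `1 - δ` times an average of values in `[l, (1 + T) * l]`; the shared
  -- part `δ * μ` is what contracts the ratio.
  have hup : ∀ i, ∑ j, A i j * y j * v j ≤
      (δ * μ + (1 - δ) * ((1 + T) * l)) * ∑ j, A i j * y j := fun i => by
    have h1 : a * ((1 + T) * l * Y - V) ≤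
        (1 + T) * l * (∑ j, A i j * y j) - ∑ j, A i j * y j * v j := by
      simp only [Y, V, mul_sum, ← sum_sub_distrib]
      refine sum_le_sum fun j _ => ?_
      have h2 : 0 ≤ y j * ((1 + T) * l - v j) := mul_nonneg (hy j).le (by linarith [hvT j j₀])
      nlinarith [(hA i j).1]
    have h3 : δ * ((1 + T) * l - μ) * (∑ j, A i j * y j) ≤ a * ((1 + T) * l * Y - V) := by
      have := mul_le_mul_of_nonneg_left (hrow i)
        (mul_nonneg hδ0.le (sub_nonneg.2 hμu))
      calc _ ≤ _ := this
        _ = δ * b * ((1 + T) * l * Y - μ * Y) := by ring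
        _ = _ := by rw [hδb, hμY]
    linarith
  have hlow : ∀ i, (δ * μ + (1 - δ) * l) * ∑ j, A i j * y j ≤
      ∑ j, A i j * y j * v j := fun i => by
    have h1 : a * (V - l * Y) ≤ (∑ j, A i j * y j * v j) - l * (∑ j, A i j * y j) := by
      simp only [Y, V, mul_sum, ← sum_sub_distrib]
      refine sum_le_sum fun j _ => ?_
      have h2 : 0 ≤ y j * (v j - l) := mul_nonneg (hy j).le (by linarith [hj₀ j])
      nlinarith [(hA i j).1]
    have h3 : δ * (μ - l) * (∑ j, A i j * y j) ≤ a * (V - l * Y) := by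
      have := mul_le_mul_of_nonneg_left (hrow i)
        (mul_nonneg hδ0.le (sub_nonneg.2 hμl))
      calc _ ≤ _ := this
        _ = δ * b * (μ * Y - l * Y) := by ring
        _ = _ := by rw [hδb, hμY]
    linarith
  have hkey : δ * μ + (1 - δ) * ((1 + T) * l) ≤
      (1 + (1 - δ) * T) * (δ * μ + (1 - δ) * l) := by
    have : 0 ≤ (1 - δ) * T * δ * (μ - l) :=
      mul_nonneg (mul_nonneg (mul_nonneg (by linarith) hT) hδ0.le) (by linarith)
    linarith
  have hc : 0 ≤ 1 + (1 - δ) * T := by nlinarith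
  calc _ ≤ (δ * μ + (1 - δ) * ((1 + T) * l)) * (∑ j, A i j * y j) * ∑ j, A k j * y j :=
        mul_le_mul_of_nonneg_right (hup i) (hpos k).le
    _ = (δ * μ + (1 - δ) * ((1 + T) * l)) * ((∑ j, A i j * y j) * ∑ j, A k j * y j) := by ring
    _ ≤ (1 + (1 - δ) * T) * (δ * μ + (1 - δ) * l) *
        ((∑ j, A i j * y j) * ∑ j, A k j * y j) :=
        mul_le_mul_of_nonneg_right hkey (mul_pos (hpos i) (hpos k)).le
    _ = (1 + (1 - δ) * T) * (((δ * μ + (1 - δ) * l) * ∑ j, A k j * y j) *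
        ∑ j, A i j * y j) := by ring
    _ ≤ _ := mul_le_mul_of_nonneg_left
        (mul_le_mul_of_nonneg_right (hlow k) (hpos i).le) hc

/-- One half-step of the stability argument: the ratios of row scaling factors are controlled by
the ratios of column scaling factors. -/
lemma scaling_ratio_le {a b ε T : ℝ} (ha : 0 < a) (hT : 0 ≤ T) (hε : 0 ≤ ε) (hε' : ε ≤ 1 / 2)
    {A : Matrix (Fin m) (Fin n) ℝ} (hA : ∀ i j, A i j ∈ Set.Icc a b)
    {r x u : Fin m → ℝ} {y v : Fin n → ℝ} (hr : ∀ i, 0 < r i) (hx : ∀ i, 0 < x i)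
    (hy : ∀ j, 0 < y j) (hu : ∀ i, 0 < u i) (hv : ∀ j, 0 < v j)
    (hrow : ∀ i, ∑ j, (u i * x i) * A i j * (v j * y j) = r i)
    (hlow : ∀ i, (1 - ε) * r i ≤ ∑ j, x i * A i j * y j)
    (hup : ∀ i, ∑ j, x i * A i j * y j ≤ (1 + ε) * r i)
    (hvT : ∀ j k, v j ≤ (1 + T) * v k) (i k : Fin m) :
    u i ≤ (1 + 4 * ε) * (1 + (1 - a / b) * T) * u k := by
  -- Up to the error `ε`, `u i` is the reciprocal of the weighted average `Gi / Si` of `v`, hence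
  -- the exchanged indices.
  have h := weighted_average_ratio_le ha hT hA hy hv hvT k i
  set Gi := ∑ j, A i j * y j * v j
  set Gk := ∑ j, A k j * y j * v j
  set Si := ∑ j, A i j * y j
  set Sk := ∑ j, A k j * y j
  set κ := 1 + (1 - a / b) * T
  have e1 : ∀ i, ∑ j, (u i * x i) * A i j * (v j * y j) = u i * x i * ∑ j, A i j * y j * v j :=
    fun i => by rw [mul_sum]; exact sum_congr rfl fun j _ => by ring
  have e2 : ∀ i, ∑ j, x i * A i j * y j = x i * ∑ j, A i j * y j :=
    fun i => by rw [mul_sum]; exact sum_congr rfl fun j _ => by ring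
  have hri : u i * x i * Gi = r i := by rw [← hrow i, e1]
  have hrk : u k * x k * Gk = r k := by rw [← hrow k, e1]
  have hli : (1 - ε) * r i ≤ x i * Si := by rw [← e2]; exact hlow i
  have hui : x k * Sk ≤ (1 + ε) * r k := by rw [← e2]; exact hup k
  have hGi : 0 < Gi := by
    have := hr i; rw [← hri] at this
    exact (pos_iff_pos_of_mul_pos this).1 (mul_pos (hu i) (hx i))
  have hGk : 0 < Gk := by
    have := hr k; rw [← hrk] at this
    exact (pos_iff_pos_of_mul_pos this).1 (mul_pos (hu k) (hx k))
  rw [← hri] at hli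
  rw [← hrk] at hui
  have hl2 : (1 - ε) * (u i * Gi) ≤ Si := by
    refine le_of_mul_le_mul_left ?_ (hx i)
    linarith
  have hu2 : Sk ≤ (1 + ε) * (u k * Gk) := by
    refine le_of_mul_le_mul_left ?_ (hx k)
    linarith
  have hκ : 0 ≤ κ := by
    by_contra hneg
    push Not at hneg
    have h1 : 0 < Gk * Si :=
      mul_pos hGk (lt_of_lt_of_le (mul_pos (by linarith) (mul_pos (hu i) hGi)) hl2)
    have h2 : 0 ≤ Sk := by
      refine sum_nonneg fun j _ => mul_nonneg (ha.le.trans (hA k j).1) (hy j).le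
    nlinarith [mul_nonneg hGi.le h2]
  have h3 : (1 - ε) * u i * (Gi * Gk) ≤ κ * (1 + ε) * u k * (Gi * Gk) := by
    calc (1 - ε) * u i * (Gi * Gk) = Gk * ((1 - ε) * (u i * Gi)) := by ring
      _ ≤ Gk * Si := mul_le_mul_of_nonneg_left hl2 hGk.le
      _ ≤ κ * (Gi * Sk) := h
      _ ≤ κ * (Gi * ((1 + ε) * (u k * Gk))) := by gcongr
      _ = _ := by ring
  have h4 := le_of_mul_le_mul_right h3 (mul_pos hGi hGk)
  have h5 : (1 + ε) ≤ (1 - ε) * (1 + 4 * ε) := by nlinarith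
  have h6 : (1 - ε) * u i ≤ (1 - ε) * ((1 + 4 * ε) * κ * u k) := by
    have : 0 ≤ κ * u k := mul_nonneg hκ (hu k).le
    nlinarith
  exact le_of_mul_le_mul_left h6 (by linarith)

/-- If `(x, y)` scales `A` approximately and `(x', y')` exactly, then the products `x i * y j` and
`x' i * y' j` are close. -/
lemma Scales.abs_mul_sub_mul_le {a b ε : ℝ} (ha : 0 < a) (hε : 0 ≤ ε) (hε' : ε ≤ a / b / 8)
    {A : Matrix (Fin m) (Fin n) ℝ} (hA : ∀ i j, A i j ∈ Set.Icc a b)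
    {r x x' : Fin m → ℝ} {c y y' : Fin n → ℝ} (hr : ∀ i, 0 < r i) (hc : ∀ j, 0 < c j)
    (hx : ∀ i, 0 < x i) (hy : ∀ j, 0 < y j) (h : Scales A r c x' y')
    (hrow : ∀ i, |∑ j, x i * A i j * y j - r i| ≤ ε * r i)
    (hcol : ∀ j, |∑ i, x i * A i j * y j - c j| ≤ ε * c j) (i : Fin m) (j : Fin n) :
    |x' i * y' j - x i * y j| ≤ 18 * ε / (a / b) * (x i * y j) := by
  obtain ⟨hx', hy', hrow', hcol'⟩ := h
  have hb : 0 < b := ha.trans_le ((hA i j).1.trans (hA i j).2)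
  set δ := a / b with hδ
  have hδ0 : 0 < δ := div_pos ha hb
  have hδ1 : δ ≤ 1 := (div_le_one hb).2 ((hA i j).1.trans (hA i j).2)
  have : Nonempty (Fin m) := ⟨i⟩
  have : Nonempty (Fin n) := ⟨j⟩
  set u : Fin m → ℝ := fun i => x' i / x i with hu_def
  set v : Fin n → ℝ := fun j => y' j / y j with hv_def
  have hu : ∀ i, 0 < u i := fun i => div_pos (hx' i) (hx i)
  have hv : ∀ j, 0 < v j := fun j => div_pos (hy' j) (hy j)
  have hux : ∀ i, u i * x i = x' i := fun i => div_mul_cancel₀ _ (hx i).ne'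
  have hvy : ∀ j, v j * y j = y' j := fun j => div_mul_cancel₀ _ (hy j).ne'
  obtain ⟨p, hp⟩ := Finite.exists_max fun p : Fin m × Fin m => u p.1 / u p.2
  obtain ⟨q, hq⟩ := Finite.exists_max fun q : Fin n × Fin n => v q.1 / v q.2
  -- One `T` measures the spread of both `u` and `v`, so that the two half-steps bound `T` by
  -- itself.
  set T := max (u p.1 / u p.2) (v q.1 / v q.2) - 1 with hT_def
  have hT : 0 ≤ T := by
    have : 1 ≤ u p.1 / u p.2 := by simpa [div_self (hu i).ne'] using hp (i, i)
    rw [hT_def]; linarith [le_max_left (u p.1 / u p.2) (v q.1 / v q.2)]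
  have huT : ∀ i k, u i ≤ (1 + T) * u k := fun i k => by
    rw [← div_le_iff₀ (hu k)]
    linarith [hp (i, k), le_max_left (u p.1 / u p.2) (v q.1 / v q.2)]
  have hvT : ∀ j k, v j ≤ (1 + T) * v k := fun j k => by
    rw [← div_le_iff₀ (hv k)]
    linarith [hq (j, k), le_max_right (u p.1 / u p.2) (v q.1 / v q.2)]
  have hu' := scaling_ratio_le (r := r) ha hT hε (by linarith) hA hr hx hy hu hv
    (fun i => by simp only [hux, hvy]; exact hrow' i)
    (fun i => by linarith [(abs_le.1 (hrow i)).1])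
    (fun i => by linarith [(abs_le.1 (hrow i)).2]) hvT p.1 p.2
  have hv' := scaling_ratio_le (r := c) (A := A.transpose) ha hT hε (by linarith)
    (fun i j => hA j i) hc hy hx hv hu
    (fun j => by
      simp only [hux, hvy, Matrix.transpose_apply]
      rw [← hcol' j]; exact sum_congr rfl fun i _ => by ring)
    (fun j => by
      have : ∑ i, y j * A.transpose j i * x i = ∑ i, x i * A i j * y j :=
        sum_congr rfl fun i _ => by rw [Matrix.transpose_apply]; ring
      linarith [(abs_le.1 (hcol j)).1])
    (fun j => by
      have : ∑ i, y j * A.transpose j i * x i = ∑ i, x i * A i j * y j :=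
        sum_congr rfl fun i _ => by rw [Matrix.transpose_apply]; ring
      linarith [(abs_le.1 (hcol j)).2]) huT q.1 q.2
  rw [← div_le_iff₀ (hu _)] at hu'
  rw [← div_le_iff₀ (hv _)] at hv'
  have hTT : 1 + T ≤ (1 + 4 * ε) * (1 + (1 - δ) * T) := by
    rw [hT_def, add_sub_cancel]; exact max_le hu' hv'
  -- The inequality above gives `δ * T ≤ 4 * ε + 4 * ε * T`, and `ε ≤ δ / 8` absorbs the last term
  -- into half of the left side.
  have hT8 : δ * T ≤ 8 * ε := by
    nlinarith [mul_nonneg hε hT, mul_nonneg hδ0.le hT, mul_nonneg (mul_nonneg hε hT) hδ0.le]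
  have hT1 : T ≤ 1 := by
    refine le_of_mul_le_mul_left ?_ hδ0
    linarith
  -- The spreads leave a free constant in each of `u` and `v`. The row equation pins the product:
  -- replacing every `v k` by `v j` costs a factor `1 + T`, so `u i * v j` is close to `r i / S`,
  -- which is close to `1`.
  have e1 : ∑ k, A i k * y k * v k * (u i * x i) = r i := by
    rw [← hrow' i]
    exact sum_congr rfl fun k _ => by rw [hux, ← hvy k]; ring
  have e2 : ∑ k, x i * A i k * y k * v j ≤ (1 + T) * (r i / u i) := by
    rw [← e1, sum_div, mul_sum]
    refine sum_le_sum fun k _ => ?_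
    have : A i k * y k * v k * (u i * x i) / u i = A i k * y k * v k * x i := by
      field_simp [(hu i).ne']
    rw [this]
    have h0 : 0 ≤ x i * A i k * y k :=
      mul_nonneg (mul_nonneg (hx i).le (ha.le.trans (hA i k).1)) (hy k).le
    calc _ ≤ x i * A i k * y k * ((1 + T) * v k) := mul_le_mul_of_nonneg_left (hvT j k) h0
      _ = _ := by ring
  have e3 : r i / u i ≤ (1 + T) * ∑ k, x i * A i k * y k * v j := by
    rw [← e1, sum_div, mul_sum]
    refine sum_le_sum fun k _ => ?_
    have : A i k * y k * v k * (u i * x i) / u i = A i k * y k * v k * x i := by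
      field_simp [(hu i).ne']
    rw [this]
    have h0 : 0 ≤ x i * A i k * y k :=
      mul_nonneg (mul_nonneg (hx i).le (ha.le.trans (hA i k).1)) (hy k).le
    calc _ = x i * A i k * y k * v k := by ring
      _ ≤ x i * A i k * y k * ((1 + T) * v j) := mul_le_mul_of_nonneg_left (hvT k j) h0
      _ = _ := by ring
  rw [← sum_mul] at e2 e3
  obtain ⟨hl, hh⟩ := abs_le.1 (hrow i)
  set S := ∑ k, x i * A i k * y k
  have hri := hr i
  set w := u i * v j with hw
  have hw0 : 0 < w := mul_pos (hu i) (hv j)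
  have f1 : S * w ≤ (1 + T) * r i := by
    have := mul_le_mul_of_nonneg_right e2 (hu i).le
    rw [mul_assoc (1 + T), div_mul_cancel₀ _ (hu i).ne'] at this
    rw [hw]; linarith
  have f2 : r i ≤ (1 + T) * (S * w) := by
    have := mul_le_mul_of_nonneg_right e3 (hu i).le
    rw [div_mul_cancel₀ _ (hu i).ne'] at this
    rw [hw]; linarith
  have g1 : (1 - ε) * w ≤ 1 + T := by
    refine le_of_mul_le_mul_right ?_ hri
    nlinarith
  have g2 : 1 ≤ (1 + T) * (1 + ε) * w := by
    refine le_of_mul_le_mul_right ?_ hri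
    have : S * w ≤ (1 + ε) * r i * w := mul_le_mul_of_nonneg_right (by linarith) hw0.le
    nlinarith
  have hεδ : ε ≤ 1 / 8 := by linarith
  have hw1 : w - 1 ≤ 2 * (T + ε) := by nlinarith
  have hw2 : 1 - w ≤ 2 * (T + ε) := by
    rcases le_or_gt 1 w with h1 | h1
    · nlinarith
    · nlinarith [mul_nonneg hε hT]
  have hfin : 2 * (T + ε) ≤ 18 * ε / δ := by
    rw [le_div_iff₀ hδ0]; nlinarith
  have hxy : x' i * y' j - x i * y j = (w - 1) * (x i * y j) := by
    rw [← hux, ← hvy, hw]; ring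
  rw [hxy, abs_mul, abs_of_pos (mul_pos (hx i) (hy j))]
  refine mul_le_mul_of_nonneg_right (abs_le.2 ⟨by linarith, by linarith⟩)
    (mul_pos (hx i) (hy j)).le

/-! ### Existence and uniqueness of the scaled matrix. -/

/-- This is stability with `ε = 0`: the factors are determined only up to a scalar, but the products
`x i * y j` are unique. -/
lemma IsScaledMatrix.eq {a b : ℝ} (ha : 0 < a) {A P P' : Matrix (Fin m) (Fin n) ℝ}
    (hA : ∀ i j, A i j ∈ Set.Icc a b) {r : Fin m → ℝ} {c : Fin n → ℝ}
    (hr : ∀ i, 0 < r i) (hc : ∀ j, 0 < c j)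
    (h : IsScaledMatrix A r c P) (h' : IsScaledMatrix A r c P') : P = P' := by
  obtain ⟨x, y, ⟨hx, hy, hrow, hcol⟩, rfl⟩ := h
  obtain ⟨x', y', hs, rfl⟩ := h'
  ext i j
  have hb : 0 < b := ha.trans_le ((hA i j).1.trans (hA i j).2)
  have := hs.abs_mul_sub_mul_le ha le_rfl (by positivity) hA hr hc hx hy
    (fun i => by simp [hrow i]) (fun j => by simp [hcol j]) i j
  simp only [mul_zero, zero_div, zero_mul, abs_nonpos_iff] at this
  simp only [Matrix.mul_diagonal, Matrix.diagonal_mul]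
  linear_combination (-A i j) * this

/-- A positive matrix can be scaled to positive row and column sums with equal totals: the
functional `y ↦ ∑ r i log (A y) i - ∑ c j log y j` has a minimizer, which gives the column
factors. -/
lemma exists_scales {a b : ℝ} (ha : 0 < a) {A : Matrix (Fin m) (Fin n) ℝ}
    (hA : ∀ i j, A i j ∈ Set.Icc a b) {r : Fin m → ℝ} {c : Fin n → ℝ}
    (hr : ∀ i, 0 < r i) (hc : ∀ j, 0 < c j) (hrc : ∑ i, r i = ∑ j, c j) :
    ∃ x y, Scales A r c x y := by
  rcases isEmpty_or_nonempty (Fin n) with hn | hn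
  · have hm : IsEmpty (Fin m) := by
      by_contra hm
      rw [not_isEmpty_iff] at hm
      have := sum_pos (fun i _ => hr i) (univ_nonempty (α := Fin m))
      simp [hrc] at this
    exact ⟨fun _ => 1, fun _ => 1, by simp [Scales]⟩
  have hA0 : ∀ i j, 0 < A i j := fun i j => ha.trans_le (hA i j).1
  have hAy : ∀ y : Fin n → ℝ, (∀ j, 0 < y j) → ∀ i, 0 < ∑ j, A i j * y j := fun y hy i =>
    sum_pos (fun j _ => mul_pos (hA0 i j) (hy j)) univ_nonempty
  set F : (Fin n → ℝ) → ℝ := fun y =>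
    ∑ i, r i * Real.log (∑ j, A i j * y j) - ∑ j, c j * Real.log (y j) with hF
  -- Equality of the two totals makes `F` homogeneous of degree zero, so the largest entry can be
  -- normalized to `1`.
  have hFs : ∀ t : ℝ, 0 < t → ∀ y : Fin n → ℝ, (∀ j, 0 < y j) →
      F (fun j => t * y j) = F y := fun t ht y hy => by
    have h1 : ∀ i, Real.log (∑ j, A i j * (t * y j)) =
        Real.log t + Real.log (∑ j, A i j * y j) := fun i => by
      rw [← Real.log_mul ht.ne' (hAy y hy i).ne', mul_sum]
      congr 1; exact sum_congr rfl fun j _ => by ring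
    simp only [hF, h1, Real.log_mul ht.ne' (hy _).ne', mul_add, sum_add_distrib, ← sum_mul, hrc]
    ring
  obtain ⟨j₀, hj₀⟩ := Finite.exists_min c
  -- `K` is chosen so that a normalized vector with an entry below `η = exp (-K)` has `F` at least
  -- `F 1`. A minimum over the cube `[η, 1]ⁿ` is then global.
  set K := max 0 ((F (fun _ => 1) - (∑ i, r i) * Real.log a) / c j₀)
  set η := Real.exp (-K)
  have hK0 : 0 ≤ K := le_max_left _ _
  have hη0 : 0 < η := Real.exp_pos _
  have hη1 : η ≤ 1 := Real.exp_le_one_iff.2 (by linarith)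
  have hK : F (fun _ => 1) - (∑ i, r i) * Real.log a ≤ c j₀ * K := by
    have := le_max_right 0 ((F (fun _ => 1) - (∑ i, r i) * Real.log a) / c j₀)
    rw [div_le_iff₀ (hc j₀)] at this
    linarith
  have hcomp : IsCompact (Set.Icc (fun _ => η : Fin n → ℝ) fun _ => 1) := isCompact_Icc
  have hmem1 : (fun _ => 1 : Fin n → ℝ) ∈ Set.Icc (fun _ => η : Fin n → ℝ) fun _ => 1 :=
    ⟨fun _ => hη1, le_rfl⟩
  have hcont : ContinuousOn F (Set.Icc (fun _ => η : Fin n → ℝ) fun _ => 1) := by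
    refine ContinuousOn.sub ?_ ?_
    · refine continuousOn_finsetSum _ fun i _ => continuousOn_const.mul ?_
      refine ContinuousOn.log (by fun_prop) fun y hy => ?_
      exact (hAy y (fun j => hη0.trans_le (hy.1 j)) i).ne'
    · refine continuousOn_finsetSum _ fun j _ => continuousOn_const.mul ?_
      refine ContinuousOn.log (by fun_prop) fun y hy => ?_
      exact (hη0.trans_le (hy.1 j)).ne'
  obtain ⟨y, hyK, hymin⟩ := hcomp.exists_isMinOn ⟨_, hmem1⟩ hcont
  have hy : ∀ j, 0 < y j := fun j => hη0.trans_le (hyK.1 j)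
  have hmin : ∀ z : Fin n → ℝ, (∀ j, 0 < z j) → F y ≤ F z := fun z hz => by
    obtain ⟨k, hk⟩ := Finite.exists_max z
    rw [← hFs (z k)⁻¹ (inv_pos.2 (hz k)) z hz]
    set w : Fin n → ℝ := fun j => (z k)⁻¹ * z j with hw
    have hw0 : ∀ j, 0 < w j := fun j => mul_pos (inv_pos.2 (hz k)) (hz j)
    have hw1 : ∀ j, w j ≤ 1 := fun j => by
      rw [hw]; dsimp only; rw [inv_mul_le_iff₀ (hz k), mul_one]; exact hk j
    have hwk : w k = 1 := inv_mul_cancel₀ (hz k).ne'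
    by_cases h : ∀ j, η ≤ w j
    · exact hymin ⟨h, hw1⟩
    · push Not at h
      obtain ⟨l, hl⟩ := h
      refine (hymin hmem1).trans ?_
      have h1 : (∑ i, r i) * Real.log a ≤ ∑ i, r i * Real.log (∑ j, A i j * w j) := by
        rw [sum_mul]
        refine sum_le_sum fun i _ => mul_le_mul_of_nonneg_left (Real.log_le_log ha ?_) (hr i).le
        calc a ≤ A i k * w k := by rw [hwk, mul_one]; exact (hA i k).1
          _ ≤ _ := single_le_sum (f := fun j => A i j * w j)
            (fun j _ => (mul_pos (hA0 i j) (hw0 j)).le) (mem_univ k)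
      have h2 : c j₀ * K ≤ - (c l * Real.log (w l)) := by
        have : Real.log (w l) ≤ -K := by
          rw [← Real.log_exp (-K)]; exact Real.log_le_log (hw0 l) hl.le
        nlinarith [hj₀ l, hc j₀, hc l]
      have h3 : -(c l * Real.log (w l)) ≤ ∑ j, -(c j * Real.log (w j)) :=
        single_le_sum (f := fun j => -(c j * Real.log (w j))) (fun j _ => by
          have := Real.log_nonpos (hw0 j).le (hw1 j)
          nlinarith [hc j]) (mem_univ l)
      rw [sum_neg_distrib] at h3
      change F (fun _ => 1) ≤ ∑ i, r i * Real.log (∑ j, A i j * w j) - ∑ j, c j * Real.log (w j)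
      linarith
  -- The vanishing partial derivatives of `F` are the column equations for `x i = r i / (A y) i`;
  -- the row equations hold by this choice of `x`.
  have hcrit : ∀ j, ∑ i, r i * (A i j / ∑ k, A i k * y k) = c j / y j := fun j => by
    set φ : ℝ → ℝ := fun t => ∑ i, r i * Real.log ((∑ k, A i k * y k) + t * A i j) -
      ∑ k, c k * Real.log (y k + t * if k = j then 1 else 0) with hφ
    have hφF : ∀ t, φ t = F (fun k => y k + t * if k = j then 1 else 0) := fun t => by
      simp only [hφ, hF]
      congr 1
      refine sum_congr rfl fun i _ => ?_
      congr 2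
      simp only [mul_add, sum_add_distrib]
      congr 1
      simp [mul_comm]
    have hφ0 : φ 0 = F y := by rw [hφF]; simp
    have hloc : IsLocalMin φ 0 := by
      have : Set.Ioi (-y j) ∈ nhds (0 : ℝ) := Ioi_mem_nhds (by linarith [hy j])
      filter_upwards [this] with t ht
      rw [hφ0, hφF]
      refine hmin _ fun k => ?_
      rcases eq_or_ne k j with rfl | hkj
      · simp only [if_true, mul_one]; linarith [Set.mem_Ioi.1 ht]
      · simp [hkj, hy k]
    have hd : HasDerivAt φ (∑ i, r i * (A i j / ∑ k, A i k * y k) -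
        ∑ k, c k * ((if k = j then 1 else 0) / y k)) 0 := by
      refine HasDerivAt.sub ?_ ?_
      · refine HasDerivAt.fun_sum fun i _ => HasDerivAt.const_mul _ ?_
        have := (((hasDerivAt_id (0 : ℝ)).mul_const (A i j)).const_add
          (∑ k, A i k * y k)).log (by simpa using (hAy y hy i).ne')
        simpa using this
      · refine HasDerivAt.fun_sum fun k _ => HasDerivAt.const_mul _ ?_
        have := (((hasDerivAt_id (0 : ℝ)).mul_const (if k = j then (1 : ℝ) else 0)).const_add
          (y k)).log (by simpa using (hy k).ne')
        simpa using this
    have h0 := hloc.hasDerivAt_eq_zero hd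
    have h1 : ∑ k, c k * ((if k = j then 1 else 0) / y k) = c j / y j := by
      rw [sum_eq_single j (fun k _ hk => by simp [hk]) (by simp)]
      simp [div_eq_mul_inv]
    linarith
  refine ⟨fun i => r i / ∑ k, A i k * y k, y, fun i => div_pos (hr i) (hAy y hy i), hy,
    fun i => ?_, fun j => ?_⟩
  · have : ∑ j, r i / (∑ k, A i k * y k) * A i j * y j =
        r i / (∑ k, A i k * y k) * ∑ j, A i j * y j := by
      rw [mul_sum]; exact sum_congr rfl fun j _ => by ring
    rw [this, div_mul_cancel₀ _ (hAy y hy i).ne']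
  · have : ∑ i, r i / (∑ k, A i k * y k) * A i j * y j =
        (∑ i, r i * (A i j / ∑ k, A i k * y k)) * y j := by
      rw [sum_mul]; exact sum_congr rfl fun i _ => by ring
    rw [this, hcrit j, div_mul_cancel₀ _ (hy j).ne']

lemma existsUnique_isScaledMatrix {a b : ℝ} (ha : 0 < a) {A : Matrix (Fin m) (Fin n) ℝ}
    (hA : ∀ i j, A i j ∈ Set.Icc a b) {r : Fin m → ℝ} {c : Fin n → ℝ}
    (hr : ∀ i, 0 < r i) (hc : ∀ j, 0 < c j) (hrc : ∑ i, r i = ∑ j, c j) :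
    ∃! P, IsScaledMatrix A r c P := by
  obtain ⟨x, y, h⟩ := exists_scales ha hA hr hc hrc
  exact ⟨_, ⟨x, y, h, rfl⟩, fun P' h' => h'.eq ha hA hr hc ⟨x, y, h, rfl⟩⟩

lemma isScaledMatrix_scaledMatrix {A : Matrix (Fin m) (Fin n) ℝ} {r : Fin m → ℝ}
    {c : Fin n → ℝ} (h : ∃ P, IsScaledMatrix A r c P) :
    IsScaledMatrix A r c (scaledMatrix A r c) := by
  rw [scaledMatrix, dif_pos h]
  exact h.choose_spec

/-! ### Size of the scaling factors. -/

lemma Scales.transpose {A : Matrix (Fin m) (Fin n) ℝ} {r x : Fin m → ℝ} {c y : Fin n → ℝ}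
    (h : Scales A r c x y) : Scales A.transpose c r y x := by
  obtain ⟨hx, hy, hr, hc⟩ := h
  refine ⟨hy, hx, fun j => ?_, fun i => ?_⟩
  · rw [← hc j]; exact sum_congr rfl fun i _ => by rw [Matrix.transpose_apply]; ring
  · rw [← hr i]; exact sum_congr rfl fun j _ => by rw [Matrix.transpose_apply]; ring

lemma Scales.mul_sum_bounds {a b : ℝ} {A : Matrix (Fin m) (Fin n) ℝ}
    (hA : ∀ i j, A i j ∈ Set.Icc a b) {r x : Fin m → ℝ} {c y : Fin n → ℝ}
    (h : Scales A r c x y) (i : Fin m) :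
    a * (x i * ∑ j, y j) ≤ r i ∧ r i ≤ b * (x i * ∑ j, y j) := by
  obtain ⟨hx, hy, hr, hc⟩ := h
  rw [← hr i]
  simp only [mul_sum]
  exact ⟨sum_le_sum fun j _ => by nlinarith [(hA i j).1, mul_pos (hx i) (hy j)],
    sum_le_sum fun j _ => by nlinarith [(hA i j).2, mul_pos (hx i) (hy j)]⟩

/-- With `X` and `Y` the sums of the factors, `a * x i * Y ≤ r i`, `a * y j * X ≤ c j` and `∑ r ≤ b
* X * Y`; the product `X * Y` cancels. -/
lemma Scales.mul_le {a b : ℝ} (ha : 0 < a) {A : Matrix (Fin m) (Fin n) ℝ}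
    (hA : ∀ i j, A i j ∈ Set.Icc a b) {r x : Fin m → ℝ} {c y : Fin n → ℝ}
    (hr : ∀ i, 0 < r i) (h : Scales A r c x y) (i : Fin m) (j : Fin n) :
    x i * y j ≤ b / a ^ 2 * (r i * c j / ∑ i, r i) := by
  have : Nonempty (Fin m) := ⟨i⟩
  have : Nonempty (Fin n) := ⟨j⟩
  have hs : 0 < ∑ i, r i := sum_pos (fun i _ => hr i) univ_nonempty
  have hX : 0 < ∑ i, x i := sum_pos (fun i _ => h.1 i) univ_nonempty
  have hY : 0 < ∑ j, y j := sum_pos (fun j _ => h.2.1 j) univ_nonempty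
  have h1 := (h.mul_sum_bounds hA i).1
  have h2 := (h.transpose.mul_sum_bounds (fun j i => hA i j) j).1
  have h3 : ∑ i, r i ≤ b * ((∑ i, x i) * ∑ j, y j) := by
    rw [sum_mul, mul_sum]
    exact sum_le_sum fun i _ => (h.mul_sum_bounds hA i).2
  have hxi := h.1 i
  have hyj := h.2.1 j
  have h4 : (a * (x i * ∑ j, y j)) * (a * (y j * ∑ i, x i)) ≤ r i * c j := by
    gcongr; exact (hr i).le
  rw [div_mul_div_comm, le_div_iff₀ (by positivity)]
  have hb : 0 < b := ha.trans_le ((hA i j).1.trans (hA i j).2)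
  calc x i * y j * (a ^ 2 * ∑ i, r i)
      ≤ x i * y j * (a ^ 2 * (b * ((∑ i, x i) * ∑ j, y j))) := by gcongr
    _ = b * ((a * (x i * ∑ j, y j)) * (a * (y j * ∑ i, x i))) := by ring
    _ ≤ b * (r i * c j) := by gcongr

/-! ### Euclidean norms, operator norms and nets. -/

lemma norm2_nonneg (v : Fin n → ℝ) : 0 ≤ norm2 v := norm_nonneg _

lemma norm2_sq (v : Fin n → ℝ) : norm2 v ^ 2 = ∑ i, v i ^ 2 :=
  EuclideanSpace.real_norm_sq_eq _

lemma dotProduct_le_norm2 (v w : Fin n → ℝ) : v ⬝ᵥ w ≤ norm2 v * norm2 w := by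
  have := real_inner_le_norm (WithLp.toLp 2 w) (WithLp.toLp 2 v)
  rw [mul_comm]
  simpa [norm2, EuclideanSpace.inner_toLp_toLp] using this

open scoped Matrix.Norms.L2Operator in
lemma opNorm_nonneg (B : Matrix (Fin m) (Fin n) ℝ) : 0 ≤ opNorm B := norm_nonneg _

open scoped Matrix.Norms.L2Operator in
lemma opNorm_add_le (B C : Matrix (Fin m) (Fin n) ℝ) : opNorm (B + C) ≤ opNorm B + opNorm C :=
  norm_add_le _ _

lemma norm2_mulVec_le (B : Matrix (Fin m) (Fin n) ℝ) (v : Fin n → ℝ) :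
    norm2 (B.mulVec v) ≤ opNorm B * norm2 v :=
  Matrix.l2_opNorm_mulVec B (WithLp.toLp 2 v)

lemma opNorm_le_of_norm2_mulVec_le {B : Matrix (Fin m) (Fin n) ℝ} {t : ℝ} (ht : 0 ≤ t)
    (h : ∀ v, norm2 (B.mulVec v) ≤ t * norm2 v) : opNorm B ≤ t :=
  ContinuousLinearMap.opNorm_le_bound _ ht fun v => h v.ofLp

lemma norm2_le_of_abs_le {v : Fin n → ℝ} {w : Fin n → ℝ} (h : ∀ i, |v i| ≤ w i) :
    norm2 v ≤ norm2 w := by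
  refine le_of_sq_le_sq ?_ (norm2_nonneg _)
  rw [norm2_sq, norm2_sq]
  exact sum_le_sum fun i _ => sq_le_sq' (by linarith [(abs_le.1 (h i)).1]) (abs_le.1 (h i)).2

lemma norm2_const_mul (t : ℝ) (v : Fin n → ℝ) : norm2 (fun i => t * v i) = |t| * norm2 v := by
  have : (fun i => t * v i) = t • v := rfl
  rw [norm2, this, WithLp.toLp_smul, norm_smul, Real.norm_eq_abs, norm2]

lemma norm2_const (t : ℝ) : norm2 (fun _ : Fin n => t) = √n * |t| := by
  rw [← abs_of_nonneg (norm2_nonneg fun _ : Fin n => t), ← Real.sqrt_sq_eq_abs, norm2_sq]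
  simp [Real.sqrt_sq_eq_abs]

/-- A matrix dominated entrywise by a rank-one matrix is dominated in operator norm. -/
lemma opNorm_le_of_abs_le_mul {B : Matrix (Fin m) (Fin n) ℝ} {t : ℝ} {α : Fin m → ℝ}
    {β : Fin n → ℝ} (ht : 0 ≤ t) (hα : ∀ i, 0 ≤ α i)
    (h : ∀ i j, |B i j| ≤ t * (α i * β j)) : opNorm B ≤ t * (norm2 α * norm2 β) := by
  refine opNorm_le_of_norm2_mulVec_le
    (mul_nonneg ht (mul_nonneg (norm2_nonneg _) (norm2_nonneg _))) fun v => ?_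
  have hv : norm2 (fun j => |v j|) = norm2 v := by
    rw [← abs_of_nonneg (norm2_nonneg v), ← abs_of_nonneg (norm2_nonneg fun j => |v j|),
      ← sq_eq_sq_iff_abs_eq_abs, norm2_sq, norm2_sq]
    simp
  have key : ∀ i, |B.mulVec v i| ≤ (t * (norm2 β * norm2 v)) * α i := fun i => by
    calc |∑ j, B i j * v j| ≤ ∑ j, |B i j * v j| := abs_sum_le_sum_abs _ _
      _ ≤ ∑ j, t * α i * (β j * |v j|) := sum_le_sum fun j _ => by
          rw [abs_mul]
          calc _ ≤ t * (α i * β j) * |v j| := mul_le_mul_of_nonneg_right (h i j) (abs_nonneg _)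
            _ = _ := by ring
      _ = t * α i * (β ⬝ᵥ fun j => |v j|) := by rw [← mul_sum]; rfl
      _ ≤ t * α i * (norm2 β * norm2 v) := by
          rw [← hv]
          exact mul_le_mul_of_nonneg_left (dotProduct_le_norm2 _ _) (mul_nonneg ht (hα i))
      _ = _ := by ring
  calc norm2 (B.mulVec v) ≤ norm2 (fun i => (t * (norm2 β * norm2 v)) * α i) :=
        norm2_le_of_abs_le key
    _ = t * (norm2 α * norm2 β) * norm2 v := by
      rw [norm2_const_mul, abs_of_nonneg
        (mul_nonneg ht (mul_nonneg (norm2_nonneg _) (norm2_nonneg _)))]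
      ring

lemma opNorm_diagonal_mul_mul_diagonal_le {B : Matrix (Fin m) (Fin n) ℝ} {x : Fin m → ℝ}
    {y : Fin n → ℝ} {α β : ℝ} (hα : 0 ≤ α) (hβ : 0 ≤ β) (hx : ∀ i, |x i| ≤ α)
    (hy : ∀ j, |y j| ≤ β) :
    opNorm (Matrix.diagonal x * B * Matrix.diagonal y) ≤ α * β * opNorm B := by
  refine opNorm_le_of_norm2_mulVec_le (mul_nonneg (mul_nonneg hα hβ) (opNorm_nonneg _)) fun v => ?_
  have h1 : ∀ {k : ℕ} (z w : Fin k → ℝ) (γ : ℝ), 0 ≤ γ → (∀ i, |z i| ≤ γ) →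
      norm2 ((Matrix.diagonal z).mulVec w) ≤ γ * norm2 w := fun z w γ hγ hz => by
    have : norm2 (fun i => γ * |w i|) = γ * norm2 w := by
      rw [← abs_of_nonneg (norm2_nonneg (fun i => γ * |w i|)),
        ← abs_of_nonneg (mul_nonneg hγ (norm2_nonneg w)), ← sq_eq_sq_iff_abs_eq_abs, mul_pow,
        norm2_sq, norm2_sq, mul_sum]
      simp [mul_pow]
    rw [← this]
    refine norm2_le_of_abs_le fun i => ?_
    rw [Matrix.mulVec_diagonal, abs_mul]
    exact mul_le_mul_of_nonneg_right (hz i) (abs_nonneg _)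
  rw [← Matrix.mulVec_mulVec, ← Matrix.mulVec_mulVec]
  calc _ ≤ α * norm2 (B.mulVec ((Matrix.diagonal y).mulVec v)) := h1 _ _ _ hα hx
    _ ≤ α * (opNorm B * (β * norm2 v)) := by
      refine mul_le_mul_of_nonneg_left ((norm2_mulVec_le _ _).trans ?_) hα
      exact mul_le_mul_of_nonneg_left (h1 _ _ _ hβ hy) (opNorm_nonneg _)
    _ = _ := by ring

/-- A net of the Euclidean ball of radius `2`, of cardinality at most `5 ^ n`. -/
lemma exists_net (n : ℕ) : ∃ s : Finset (Fin n → ℝ), s.card ≤ 5 ^ n ∧ (∀ p ∈ s, norm2 p ≤ 2) ∧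
    ∀ v, norm2 v ≤ 2 → ∃ p ∈ s, norm2 (v - p) ≤ 1 := by
  classical
  let Sep : Finset (EuclideanSpace ℝ (Fin n)) → Prop := fun s =>
    (∀ c ∈ s, ‖c‖ ≤ 2) ∧ ∀ c ∈ s, ∀ d ∈ s, c ≠ d → 1 ≤ ‖c - d‖
  have hcard : ∀ s, Sep s → s.card ≤ 5 ^ n := fun s hs => by
    simpa using Besicovitch.card_le_of_separated s hs.1 hs.2
  have hfin : {k | ∃ s, Sep s ∧ s.card = k}.Finite :=
    (Set.finite_Iic (5 ^ n)).subset fun k ⟨s, hs, hk⟩ => hk ▸ hcard s hs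
  -- A separated set of maximal cardinality is a net: an uncovered point could be added to it.
  obtain ⟨k, ⟨s, hs, rfl⟩, hmax⟩ := hfin.exists_maximal ⟨0, ∅, by simp [Sep], rfl⟩
  refine ⟨s.image WithLp.ofLp, card_image_le.trans (hcard s hs), ?_, fun v hv => ?_⟩
  · intro p hp
    obtain ⟨c, hc, rfl⟩ := mem_image.1 hp
    exact hs.1 c hc
  · by_contra! hcon
    have hfar : ∀ c ∈ s, 1 < ‖WithLp.toLp 2 v - c‖ := fun c hc =>
      hcon _ (mem_image_of_mem _ hc)
    have hv' : WithLp.toLp 2 v ∉ s := fun h => by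
      have := hfar _ h
      rw [sub_self, norm_zero] at this
      linarith
    have hs' : Sep (insert (WithLp.toLp 2 v) s) := by
      refine ⟨fun c hc => ?_, fun c hc d hd hcd => ?_⟩
      · rcases mem_insert.1 hc with rfl | hc
        · exact hv
        · exact hs.1 c hc
      · rcases mem_insert.1 hc with rfl | hc <;> rcases mem_insert.1 hd with rfl | hd
        · exact absurd rfl hcd
        · exact (hfar d hd).le
        · rw [norm_sub_rev]; exact (hfar c hc).le
        · exact hs.2 c hc d hd hcd
    have := hmax ⟨_, hs', rfl⟩ (by simp [card_insert_of_notMem hv'])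
    simp [card_insert_of_notMem hv'] at this

/-- The net point near `2 * w / ‖w‖` loses at most `‖w‖` of the inner product `2 * ‖w‖`, so radius
`2` and mesh `1` cost no constant. -/
lemma norm2_le_of_net {s : Finset (Fin n → ℝ)}
    (hs : ∀ v, norm2 v ≤ 2 → ∃ p ∈ s, norm2 (v - p) ≤ 1) {w : Fin n → ℝ} {t : ℝ}
    (h : ∀ p ∈ s, p ⬝ᵥ w ≤ t) : norm2 w ≤ t := by
  have hw := norm2_nonneg w
  have hww : w ⬝ᵥ w = norm2 w ^ 2 := by
    rw [norm2_sq]; exact sum_congr rfl fun i _ => (sq _).symm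
  obtain ⟨p, hp, hvp⟩ := hs (fun i => 2 / norm2 w * w i) (by
    rw [norm2_const_mul, abs_of_nonneg (by positivity)]
    rcases hw.eq_or_lt with h0 | h0
    · rw [← h0]; simp
    · rw [div_mul_cancel₀ _ h0.ne'])
  have h1 := dotProduct_le_norm2 ((fun i => 2 / norm2 w * w i) - p) w
  have h2 : (fun i => 2 / norm2 w * w i) ⬝ᵥ w = 2 * norm2 w := by
    have : (fun i => 2 / norm2 w * w i) = (2 / norm2 w) • w := rfl
    rw [this, smul_dotProduct, hww, smul_eq_mul]
    rcases hw.eq_or_lt with h0 | h0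
    · rw [← h0]; simp
    · field_simp
  rw [sub_dotProduct, h2] at h1
  nlinarith [h p hp]

/-- The operator norm is controlled by the bilinear form on nets. -/
lemma opNorm_le_of_net {s : Finset (Fin m → ℝ)} {s' : Finset (Fin n → ℝ)}
    (hs : ∀ v, norm2 v ≤ 2 → ∃ p ∈ s, norm2 (v - p) ≤ 1)
    (hs' : ∀ v, norm2 v ≤ 2 → ∃ p ∈ s', norm2 (v - p) ≤ 1)
    {B : Matrix (Fin m) (Fin n) ℝ} {t : ℝ} (ht : 0 ≤ t)
    (h : ∀ p ∈ s, ∀ q ∈ s', p ⬝ᵥ B.mulVec q ≤ t) : opNorm B ≤ t := by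
  have hq : ∀ q ∈ s', norm2 (B.mulVec q) ≤ t := fun q hq =>
    norm2_le_of_net hs fun p hp => h p hp q hq
  have hadd : ∀ {k : ℕ} (v w : Fin k → ℝ), norm2 (v + w) ≤ norm2 v + norm2 w := fun v w => by
    rw [norm2, WithLp.toLp_add]; exact norm_add_le _ _
  have hB := opNorm_nonneg B
  have hball : ∀ v, norm2 v ≤ 2 → norm2 (B.mulVec v) ≤ t + opNorm B := fun v hv => by
    obtain ⟨q, hqs, hvq⟩ := hs' v hv
    have e : B.mulVec v = B.mulVec q + B.mulVec (v - q) := by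
      rw [← Matrix.mulVec_add, add_sub_cancel]
    rw [e]
    refine (hadd _ _).trans (add_le_add (hq q hqs) ?_)
    exact (norm2_mulVec_le _ _).trans (by nlinarith)
  -- On the ball of radius `2`, passing to the net costs one `opNorm B`; rescaling to the unit ball
  -- halves this, and it can be absorbed.
  have h2 : opNorm B ≤ (t + opNorm B) / 2 := by
    refine opNorm_le_of_norm2_mulVec_le (by positivity) fun v => ?_
    rcases (norm2_nonneg v).eq_or_lt with h0 | h0
    · have := norm2_mulVec_le B v
      rw [← h0] at this ⊢
      linarith
    · have h3 := hball (fun i => 2 / norm2 v * v i) (by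
        rw [norm2_const_mul, abs_of_nonneg (by positivity), div_mul_cancel₀ _ h0.ne'])
      have e : B.mulVec (fun i => 2 / norm2 v * v i) = fun i => 2 / norm2 v * B.mulVec v i := by
        have : (fun i => 2 / norm2 v * v i) = (2 / norm2 v) • v := rfl
        rw [this, Matrix.mulVec_smul]; rfl
      rw [e, norm2_const_mul, abs_of_nonneg (by positivity), div_mul_eq_mul_div,
        div_le_iff₀ h0] at h3
      linarith
  linarith

/-! ### The quantities `ρ₁`, `ρ₂`, `ρ₃` and the deterministic comparison. -/

lemma sum_le_sqrt_mul_norm2 (v : Fin n → ℝ) : ∑ i, v i ≤ √n * norm2 v := by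
  have := dotProduct_le_norm2 (fun _ => 1) v
  rw [norm2_const] at this
  simpa [dotProduct] using this

lemma norm2_le_sqrt_mul_iSup {v : Fin n → ℝ} (hv : ∀ i, 0 < v i) :
    norm2 v ≤ √n * ⨆ i, v i := by
  have h0 : 0 ≤ ⨆ i, v i := Real.iSup_nonneg fun i => (hv i).le
  rw [← abs_of_nonneg h0, ← norm2_const]
  refine norm2_le_of_abs_le fun i => ?_
  rw [abs_of_pos (hv i)]
  exact le_ciSup (Set.finite_range v).bddAbove i

lemma div_sum_le_rho1_left (r : Fin m → ℝ) (c : Fin n → ℝ) : norm2 r / ∑ i, r i ≤ rho1 r c :=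
  le_max_left _ _

lemma div_sum_le_rho1_right (r : Fin m → ℝ) (c : Fin n → ℝ) : norm2 c / ∑ j, c j ≤ rho1 r c :=
  le_max_right _ _

lemma one_le_sqrt_mul_norm2_div {v : Fin n → ℝ} (hv : 0 < ∑ i, v i) :
    1 ≤ √n * (norm2 v / ∑ i, v i) := by
  rw [← mul_div_assoc, one_le_div hv]
  exact sum_le_sqrt_mul_norm2 v

/-- The comparison below is obtained without `ρ₂`; this bound inserts the factor at the end. -/
lemma one_le_rho2 [Nonempty (Fin m)] {r : Fin m → ℝ} (hr : ∀ i, 0 < r i) (c : Fin n → ℝ) :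
    1 ≤ rho2 r c := by
  refine le_trans ?_ (le_max_left _ _)
  obtain ⟨i, hi⟩ := exists_eq_ciInf_of_finite (f := r)
  have hm : 0 < m := Fin.pos i
  rw [one_le_div (mul_pos (by exact_mod_cast hm) (hi ▸ hr i))]
  have := card_nsmul_le_sum univ r (⨅ i, r i) fun j _ =>
    ciInf_le (Set.finite_range r).bddBelow j
  simpa using this

lemma norm2_mul_norm2_div_le_rho3 {r : Fin m → ℝ} {c : Fin n → ℝ} (hr : ∀ i, 0 < r i)
    (hc : ∀ j, 0 < c j) : norm2 r * norm2 c / ∑ i, r i ≤ rho3 r c := by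
  refine div_le_div_of_nonneg_right ?_ (sum_nonneg fun i _ => (hr i).le)
  refine mul_le_mul (norm2_le_sqrt_mul_iSup hr) (norm2_le_sqrt_mul_iSup hc) (norm2_nonneg _) ?_
  exact mul_nonneg (Real.sqrt_nonneg _) (Real.iSup_nonneg fun i => (hr i).le)

lemma rho3_nonneg {r : Fin m → ℝ} {c : Fin n → ℝ} (hr : ∀ i, 0 < r i)
    (hc : ∀ j, 0 < c j) : 0 ≤ rho3 r c :=
  le_trans (div_nonneg (mul_nonneg (norm2_nonneg _) (norm2_nonneg _))
    (sum_nonneg fun i _ => (hr i).le)) (norm2_mul_norm2_div_le_rho3 hr hc)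

/-- The relative error of the row sums when the scaling factors of `A` are applied to `A'`. -/
lemma Scales.abs_row_sum_sub_le {a b t : ℝ} (ha : 0 < a) (ht : 0 ≤ t)
    {A A' : Matrix (Fin m) (Fin n) ℝ} (hA : ∀ i j, A i j ∈ Set.Icc a b)
    {r x : Fin m → ℝ} {c y : Fin n → ℝ} (hc : ∀ j, 0 < c j)
    (hrc : ∑ i, r i = ∑ j, c j) (h : Scales A r c x y) (i : Fin m)
    (hE : |∑ j, (A' i j - A i j) * y j| ≤ 2 * b * norm2 y * t) :
    |∑ j, x i * A' i j * y j - r i| ≤ 2 * (b / a) ^ 2 * (norm2 c / (∑ j, c j) * t) * r i := by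
  have hxi := h.1 i
  have hm : Nonempty (Fin m) := ⟨i⟩
  rcases isEmpty_or_nonempty (Fin n) with hn | hn
  · have := h.2.2.1 i
    simp at this
    simp [← this]
  obtain ⟨j₀⟩ := id hn
  have hb : 0 < b := ha.trans_le ((hA i j₀).1.trans (hA i j₀).2)
  have hX : 0 < ∑ i, x i := sum_pos (fun i _ => h.1 i) univ_nonempty
  have hY : 0 < ∑ j, y j := sum_pos (fun j _ => h.2.1 j) univ_nonempty
  have hs : 0 < ∑ j, c j := sum_pos (fun j _ => hc j) univ_nonempty
  have h1 : a * (∑ i, x i) * norm2 y ≤ norm2 c := by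
    rw [← abs_of_pos (mul_pos ha hX), ← norm2_const_mul]
    refine norm2_le_of_abs_le fun j => ?_
    rw [abs_of_pos (mul_pos (mul_pos ha hX) (h.2.1 j))]
    linarith [(h.transpose.mul_sum_bounds (fun j i => hA i j) j).1]
  have h2 : ∑ j, c j ≤ b * ((∑ i, x i) * ∑ j, y j) := by
    rw [← hrc, sum_mul, mul_sum]
    exact sum_le_sum fun i _ => (h.mul_sum_bounds hA i).2
  -- Each `y j` is proportional to `c j` up to constants, so `‖y‖₂ / ‖y‖₁` is controlled by `‖c‖₂ /
  -- ‖c‖₁`.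
  have h3 : norm2 y ≤ b / a * (norm2 c / ∑ j, c j) * ∑ j, y j := by
    rw [div_mul_div_comm, div_mul_eq_mul_div, le_div_iff₀ (mul_pos ha hs)]
    calc norm2 y * (a * ∑ j, c j) ≤ norm2 y * (a * (b * ((∑ i, x i) * ∑ j, y j))) := by
          have := norm2_nonneg y
          gcongr
      _ = b * (∑ j, y j) * (a * (∑ i, x i) * norm2 y) := by ring
      _ ≤ b * (∑ j, y j) * norm2 c := mul_le_mul_of_nonneg_left h1 (mul_pos hb hY).le
      _ = _ := by ring
  have e : ∑ j, x i * A' i j * y j - r i = x i * ∑ j, (A' i j - A i j) * y j := by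
    rw [← h.2.2.1 i, mul_sum, ← sum_sub_distrib]
    exact sum_congr rfl fun j _ => by ring
  rw [e, abs_mul, abs_of_pos hxi]
  have hq : 0 ≤ norm2 c / ∑ j, c j := div_nonneg (norm2_nonneg _) hs.le
  calc x i * |∑ j, (A' i j - A i j) * y j| ≤ x i * (2 * b * norm2 y * t) := by gcongr
    _ ≤ x i * (2 * b * (b / a * (norm2 c / ∑ j, c j) * ∑ j, y j) * t) := by gcongr
    _ = 2 * (b / a) ^ 2 * (norm2 c / (∑ j, c j) * t) * (a * (x i * ∑ j, y j)) := by
      field_simp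
    _ ≤ _ := mul_le_mul_of_nonneg_left (h.mul_sum_bounds hA i).1 (by positivity)

/-- Deterministic comparison of the scalings of two matrices `A` and `A'`. -/
lemma Scales.opNorm_sub_le {a b t : ℝ} (ha : 0 < a) (ht : 1 ≤ t)
    [Nonempty (Fin m)] [Nonempty (Fin n)]
    {A A' P' : Matrix (Fin m) (Fin n) ℝ} (hA : ∀ i j, A i j ∈ Set.Icc a b)
    (hA' : ∀ i j, A' i j ∈ Set.Icc a b)
    {r x : Fin m → ℝ} {c y : Fin n → ℝ} (hr : ∀ i, 0 < r i) (hc : ∀ j, 0 < c j)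
    (hrc : ∑ i, r i = ∑ j, c j) (h : Scales A r c x y) (hP' : IsScaledMatrix A' r c P')
    (hrow : ∀ i, |∑ j, (A' i j - A i j) * y j| ≤ 2 * b * norm2 y * t)
    (hcol : ∀ j, |∑ i, (A' i j - A i j) * x i| ≤ 2 * b * norm2 x * t)
    (hop : opNorm (A' - A) ≤ 10 * b * √(m + n)) :
    opNorm (P' - Matrix.diagonal x * A * Matrix.diagonal y) ≤
      (36 * (b / a) ^ 5 + 20 * (b / a) ^ 2) * (rho1 r c * rho2 r c * rho3 r c * t) := by
  obtain ⟨x', y', h', rfl⟩ := hP'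
  obtain ⟨i₀⟩ := id ‹Nonempty (Fin m)›
  obtain ⟨j₀⟩ := id ‹Nonempty (Fin n)›
  have hab : a ≤ b := (hA i₀ j₀).1.trans (hA i₀ j₀).2
  have hb : 0 < b := ha.trans_le hab
  have hs : 0 < ∑ i, r i := sum_pos (fun i _ => hr i) univ_nonempty
  have hs' : 0 < ∑ j, c j := sum_pos (fun j _ => hc j) univ_nonempty
  have hρ1 : 0 ≤ rho1 r c :=
    (div_nonneg (norm2_nonneg _) hs.le).trans (div_sum_le_rho1_left r c)
  have hρ3 := rho3_nonneg hr hc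
  set ε := 2 * (b / a) ^ 2 * (rho1 r c * t) with hε_def
  have hε : 0 ≤ ε := by positivity
  have hrow' : ∀ i, |∑ j, x i * A' i j * y j - r i| ≤ ε * r i := fun i => by
    refine (h.abs_row_sum_sub_le ha (by linarith) hA hc hrc i (hrow i)).trans ?_
    have := (hr i).le
    have := div_sum_le_rho1_right r c
    rw [hε_def]
    gcongr
  have hcol' : ∀ j, |∑ i, x i * A' i j * y j - c j| ≤ ε * c j := fun j => by
    have := h.transpose.abs_row_sum_sub_le (A' := A'.transpose) ha (zero_le_one.trans ht)
      (fun j i => hA i j) hr hrc.symm j (hcol j)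
    simp only [Matrix.transpose_apply] at this
    have e : ∑ i, x i * A' i j * y j = ∑ i, y j * A' i j * x i :=
      sum_congr rfl fun i _ => by ring
    rw [e]
    refine this.trans ?_
    have := (hc j).le
    have := div_sum_le_rho1_left r c
    rw [hε_def]
    gcongr
  have hxy := h.mul_le ha hA hr
  have hxy' := h'.mul_le ha hA' hr
  have hratio : 0 < a / b := div_pos ha hb
  have hprod : ∀ i j, |x' i * y' j - x i * y j| ≤
      18 * ε / (a / b) * (b / a ^ 2 * (r i * c j / ∑ i, r i)) := fun i j => by
    -- No smallness of `ε` is needed: if it is large, then `18 * ε / (a / b) ≥ 1` and the a priori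
    -- bound `Scales.mul_le` on both products suffices.
    rcases le_or_gt ε (a / b / 8) with hε' | hε'
    · refine (h'.abs_mul_sub_mul_le ha hε hε' hA' hr hc h.1 h.2.1 hrow' hcol' i j).trans ?_
      exact mul_le_mul_of_nonneg_left (hxy i j) (by positivity)
    · have h1 : 1 ≤ 18 * ε / (a / b) := by
        rw [one_le_div hratio]; linarith
      have h0 := mul_pos (h.1 i) (h.2.1 j)
      have h0' := mul_pos (h'.1 i) (h'.2.1 j)
      have h2 : |x' i * y' j - x i * y j| ≤ b / a ^ 2 * (r i * c j / ∑ i, r i) :=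
        abs_le.2 ⟨by linarith [hxy i j], by linarith [hxy' i j]⟩
      exact h2.trans (le_mul_of_one_le_left (h0.le.trans (hxy i j)) h1)
  have hsplit : Matrix.diagonal x' * A' * Matrix.diagonal y' -
      Matrix.diagonal x * A * Matrix.diagonal y =
      Matrix.of (fun i j => (x' i * y' j - x i * y j) * A' i j) +
      Matrix.diagonal x * (A' - A) * Matrix.diagonal y := by
    ext i j
    simp only [Matrix.sub_apply, Matrix.add_apply, Matrix.of_apply, Matrix.mul_diagonal,
      Matrix.diagonal_mul]
    ring
  have hfirst : opNorm (Matrix.of fun i j => (x' i * y' j - x i * y j) * A' i j) ≤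
      36 * (b / a) ^ 5 * (rho1 r c * rho3 r c * t) := by
    have hbd : ∀ i j, |(Matrix.of fun i j => (x' i * y' j - x i * y j) * A' i j) i j| ≤
        (18 * ε / (a / b) * (b / a) ^ 2 / ∑ i, r i) * (r i * c j) := fun i j => by
      rw [Matrix.of_apply, abs_mul, abs_of_pos (ha.trans_le (hA' i j).1)]
      have := mul_le_mul (hprod i j) (hA' i j).2 (ha.le.trans (hA' i j).1)
        ((abs_nonneg _).trans (hprod i j))
      refine this.trans_eq ?_
      field_simp
    refine (opNorm_le_of_abs_le_mul (by positivity) (fun i => (hr i).le) hbd).trans ?_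
    calc 18 * ε / (a / b) * (b / a) ^ 2 / (∑ i, r i) * (norm2 r * norm2 c)
        = 18 * ε / (a / b) * (b / a) ^ 2 * (norm2 r * norm2 c / ∑ i, r i) := by ring
      _ ≤ 18 * ε / (a / b) * (b / a) ^ 2 * rho3 r c :=
        mul_le_mul_of_nonneg_left (norm2_mul_norm2_div_le_rho3 hr hc) (by positivity)
      _ = _ := by rw [hε_def]; field_simp; ring
  have hsecond : opNorm (Matrix.diagonal x * (A' - A) * Matrix.diagonal y) ≤
      20 * (b / a) ^ 2 * (rho1 r c * rho3 r c * t) := by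
    obtain ⟨i₁, hi₁⟩ := Finite.exists_max x
    obtain ⟨j₁, hj₁⟩ := Finite.exists_max y
    have h1 := opNorm_diagonal_mul_mul_diagonal_le (B := A' - A) (h.1 i₁).le (h.2.1 j₁).le
      (fun i => by rw [abs_of_pos (h.1 i)]; exact hi₁ i)
      (fun j => by rw [abs_of_pos (h.2.1 j)]; exact hj₁ j)
    set R := ⨆ i, r i
    set C := ⨆ j, c j
    have hR : ∀ i, r i ≤ R := fun i => le_ciSup (Set.finite_range r).bddAbove i
    have hC : ∀ j, c j ≤ C := fun j => le_ciSup (Set.finite_range c).bddAbove j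
    have hR0 : 0 ≤ R := (hr i₀).le.trans (hR i₀)
    have hC0 : 0 ≤ C := (hc j₀).le.trans (hC j₀)
    have h2 : x i₁ * y j₁ ≤ b / a ^ 2 * (R * C / ∑ i, r i) := by
      refine (hxy i₁ j₁).trans ?_
      have := hR i₁
      have := hC j₁
      have := (hc j₁).le
      gcongr
    -- By Cauchy–Schwarz `ρ₁` is at least `1 / √m` and `1 / √n`, so `√m + √n ≤ 2 * ρ₁ * √m * √n`.
    have h3 : √(m + n : ℝ) ≤ 2 * (rho1 r c * (√m * √n)) := by
      have hmr := (one_le_sqrt_mul_norm2_div hs).trans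
        (mul_le_mul_of_nonneg_left (div_sum_le_rho1_left r c) (Real.sqrt_nonneg m))
      have hnc := (one_le_sqrt_mul_norm2_div hs').trans
        (mul_le_mul_of_nonneg_left (div_sum_le_rho1_right r c) (Real.sqrt_nonneg n))
      have h4 : √(m + n : ℝ) ≤ √m + √n := by
        refine Real.sqrt_le_iff.2 ⟨by positivity, ?_⟩
        have h5 := Real.sq_sqrt (Nat.cast_nonneg (α := ℝ) m)
        have h6 := Real.sq_sqrt (Nat.cast_nonneg (α := ℝ) n)
        nlinarith [mul_nonneg (Real.sqrt_nonneg m) (Real.sqrt_nonneg n)]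
      nlinarith [mul_le_mul_of_nonneg_left hmr (Real.sqrt_nonneg n),
        mul_le_mul_of_nonneg_left hnc (Real.sqrt_nonneg m)]
    calc _ ≤ _ := h1
      _ ≤ b / a ^ 2 * (R * C / ∑ i, r i) * (10 * b * (2 * (rho1 r c * (√m * √n)))) := by
        refine mul_le_mul h2 (hop.trans ?_) (opNorm_nonneg _) (by positivity)
        gcongr
      _ = 20 * (b / a) ^ 2 * (rho1 r c * rho3 r c) := by
        rw [rho3]; field_simp; ring
      _ ≤ _ := by
        refine mul_le_mul_of_nonneg_left ?_ (by positivity)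
        exact le_mul_of_one_le_right (mul_nonneg hρ1 hρ3) ht
  have hρ2 := one_le_rho2 hr c
  rw [hsplit]
  calc _ ≤ _ := opNorm_add_le _ _
    _ ≤ _ := add_le_add hfirst hsecond
    _ = (36 * (b / a) ^ 5 + 20 * (b / a) ^ 2) * (rho1 r c * 1 * rho3 r c * t) := by ring
    _ ≤ _ := by gcongr

end MatrixScaling

namespace MatrixScaling

open Finset MeasureTheory ProbabilityTheory Filter Topology

variable {m n : ℕ} {Ω : Type*} [MeasurableSpace Ω] {μ : Measure Ω}
  {A : Ω → Matrix (Fin m) (Fin n) ℝ} {a b : ℝ}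

/-! ### Concentration inequalities. -/

lemma expectedMatrix_mem_Icc [IsProbabilityMeasure μ]
    (hmeas : ∀ i j, Measurable fun ω => A ω i j)
    (hab : ∀ i j, ∀ᵐ ω ∂μ, A ω i j ∈ Set.Icc a b) (i : Fin m) (j : Fin n) :
    expectedMatrix μ A i j ∈ Set.Icc a b := by
  have hAint : Integrable (fun ω => A ω i j) μ :=
    Integrable.of_mem_Icc a b (hmeas i j).aemeasurable (hab i j)
  rw [expectedMatrix, Matrix.of_apply]
  constructor
  · have := integral_mono_ae (integrable_const a) hAint ((hab i j).mono fun ω h => h.1)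
    simpa using this
  · have := integral_mono_ae hAint (integrable_const b) ((hab i j).mono fun ω h => h.2)
    simpa using this

/-- Hoeffding's inequality for linear combinations of the centered entries of a random matrix. -/
lemma measureReal_le_sum_le [IsProbabilityMeasure μ]
    (hmeas : ∀ i j, Measurable fun ω => A ω i j)
    (hindep : iIndepFun (fun (p : Fin m × Fin n) (ω : Ω) => A ω p.1 p.2) μ)
    (ha : 0 ≤ a) (hle : a ≤ b)
    (hab : ∀ i j, ∀ᵐ ω ∂μ, A ω i j ∈ Set.Icc a b) (w : Fin m × Fin n → ℝ) {W t : ℝ}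
    (hW : ∑ p, w p ^ 2 ≤ W) (ht : 0 ≤ t) :
    μ.real {ω | t ≤ ∑ p, w p * (A ω p.1 p.2 - expectedMatrix μ A p.1 p.2)} ≤
      Real.exp (-t ^ 2 / (2 * (b ^ 2 * W))) := by
  have hW0 : 0 ≤ W := (sum_nonneg fun p _ => sq_nonneg (w p)).trans hW
  have hind : iIndepFun (fun (p : Fin m × Fin n) (ω : Ω) =>
      w p * (A ω p.1 p.2 - expectedMatrix μ A p.1 p.2)) μ :=
    hindep.comp (fun p z => w p * (z - expectedMatrix μ A p.1 p.2)) fun p => by fun_prop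
  have hsub := HasSubgaussianMGF.sum_of_iIndepFun hind (s := univ) fun p _ =>
    (hasSubgaussianMGF_of_mem_Icc (hmeas p.1 p.2).aemeasurable (hab p.1 p.2)).const_mul (w p)
  have hsub' : HasSubgaussianMGF
      (fun ω => ∑ p, w p * (A ω p.1 p.2 - expectedMatrix μ A p.1 p.2))
      ⟨b ^ 2 * W, by positivity⟩ μ := by
    refine ⟨hsub.1, fun s => (hsub.2 s).trans (Real.exp_le_exp.2 ?_)⟩
    refine div_le_div_of_nonneg_right (mul_le_mul_of_nonneg_right ?_ (sq_nonneg s)) zero_le_two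
    -- Hoeffding's variance proxy `((b - a) / 2) ^ 2` is weakened to `b ^ 2`.
    have h1 : |b - a| / 2 ≤ b := by rw [abs_of_nonneg (by linarith)]; linarith
    have h0 : 0 ≤ ∑ p, w p ^ 2 := sum_nonneg fun p _ => sq_nonneg (w p)
    calc _ = ∑ p, w p ^ 2 * (|b - a| / 2) ^ 2 := by
          rw [NNReal.coe_sum]
          exact sum_congr rfl fun p _ => rfl
      _ = (|b - a| / 2) ^ 2 * ∑ p, w p ^ 2 := by rw [← sum_mul, mul_comm]
      _ ≤ b ^ 2 * W := mul_le_mul (by gcongr) hW h0 (sq_nonneg b)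
  exact hsub'.measure_ge_le ht

lemma measureReal_le_abs_sum_le [IsProbabilityMeasure μ]
    (hmeas : ∀ i j, Measurable fun ω => A ω i j)
    (hindep : iIndepFun (fun (p : Fin m × Fin n) (ω : Ω) => A ω p.1 p.2) μ)
    (ha : 0 ≤ a) (hle : a ≤ b)
    (hab : ∀ i j, ∀ᵐ ω ∂μ, A ω i j ∈ Set.Icc a b) (w : Fin m × Fin n → ℝ) {W t : ℝ}
    (hW : ∑ p, w p ^ 2 ≤ W) (ht : 0 ≤ t) :
    μ.real {ω | t ≤ |∑ p, w p * (A ω p.1 p.2 - expectedMatrix μ A p.1 p.2)|} ≤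
      2 * Real.exp (-t ^ 2 / (2 * (b ^ 2 * W))) := by
  have h1 := measureReal_le_sum_le hmeas hindep ha hle hab w hW ht
  have h2 := measureReal_le_sum_le hmeas hindep ha hle hab (-w) (by simpa using hW) ht
  rw [two_mul]
  refine le_trans (measureReal_mono ?_) ((measureReal_union_le _ _).trans (add_le_add h1 h2))
  intro ω hω
  rcases le_abs.1 (Set.mem_ofPred.1 hω) with h | h
  · exact Or.inl h
  · right
    simpa [sum_neg_distrib] using h

/-- Concentration of the operator norm of a random matrix with independent bounded entries. -/
lemma measureReal_opNorm_sub_gt_le [IsProbabilityMeasure μ]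
    (hmeas : ∀ i j, Measurable fun ω => A ω i j)
    (hindep : iIndepFun (fun (p : Fin m × Fin n) (ω : Ω) => A ω p.1 p.2) μ)
    (ha : 0 < a) (hle : a ≤ b)
    (hab : ∀ i j, ∀ᵐ ω ∂μ, A ω i j ∈ Set.Icc a b) :
    μ.real {ω | 10 * b * √(m + n) < opNorm (A ω - expectedMatrix μ A)} ≤
      Real.exp (-(m + n)) := by
  have hb : 0 < b := ha.trans_le hle
  obtain ⟨s, hcard, hs2, hs⟩ := exists_net m
  obtain ⟨s', hcard', hs2', hs'⟩ := exists_net n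
  have hsub : {ω | 10 * b * √(m + n) < opNorm (A ω - expectedMatrix μ A)} ⊆
      ⋃ z ∈ s ×ˢ s', {ω | 10 * b * √(m + n) ≤ ∑ p : Fin m × Fin n,
        (z.1 p.1 * z.2 p.2) * (A ω p.1 p.2 - expectedMatrix μ A p.1 p.2)} := by
    intro ω hω
    by_contra hcon
    simp only [Set.mem_iUnion, Set.mem_ofPred, not_exists, not_le, mem_product] at hcon
    refine absurd (Set.mem_ofPred.1 hω) (not_lt.2 ?_)
    refine opNorm_le_of_net hs hs' (by positivity) fun p hp q hq => ?_
    refine (le_of_eq ?_).trans (hcon (p, q) ⟨hp, hq⟩).le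
    rw [Fintype.sum_prod_type]
    simp only [dotProduct, Matrix.mulVec, mul_sum, Matrix.sub_apply]
    exact sum_congr rfl fun i _ => sum_congr rfl fun j _ => by ring
  -- Net points have norm at most `2`, so the squared weights sum to at most `16` and the exponent
  -- is `100 / 32 ≥ 3` times `m + n`. The union over at most `5 ^ (m + n) ≤ exp (2 * (m + n))` pairs
  -- leaves `exp (-(m + n))`.
  have hz : ∀ z ∈ s ×ˢ s', μ.real {ω | 10 * b * √(m + n) ≤ ∑ p : Fin m × Fin n,
        (z.1 p.1 * z.2 p.2) * (A ω p.1 p.2 - expectedMatrix μ A p.1 p.2)} ≤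
      Real.exp (-(3 * (m + n))) := fun z hz => by
    obtain ⟨hz1, hz2⟩ := mem_product.1 hz
    have hW : ∑ p : Fin m × Fin n, (z.1 p.1 * z.2 p.2) ^ 2 ≤ 16 := by
      have e : ∑ p : Fin m × Fin n, (z.1 p.1 * z.2 p.2) ^ 2 =
          norm2 z.1 ^ 2 * norm2 z.2 ^ 2 := by
        rw [norm2_sq, norm2_sq, sum_mul_sum, Fintype.sum_prod_type]
        simp only [mul_pow]
      rw [e]
      have h1 : norm2 z.1 ^ 2 ≤ 4 := by nlinarith [norm2_nonneg z.1, hs2 _ hz1]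
      have h2 : norm2 z.2 ^ 2 ≤ 4 := by nlinarith [norm2_nonneg z.2, hs2' _ hz2]
      nlinarith [sq_nonneg (norm2 z.1), sq_nonneg (norm2 z.2)]
    refine (measureReal_le_sum_le hmeas hindep ha.le hle hab _ hW (by positivity)).trans ?_
    rw [Real.exp_le_exp, mul_pow, Real.sq_sqrt (by positivity)]
    have : -((10 * b) ^ 2 * ((m : ℝ) + n)) / (2 * (b ^ 2 * 16)) = -(25 / 8 * (m + n)) := by
      field_simp; ring
    rw [this]
    have : (0 : ℝ) ≤ m + n := by positivity
    linarith
  have h5 : (5 : ℝ) ≤ Real.exp 2 := by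
    have := Real.exp_one_gt_d9
    have e : Real.exp 2 = Real.exp 1 * Real.exp 1 := by rw [← Real.exp_add]; norm_num
    nlinarith
  calc _ ≤ _ := measureReal_mono hsub (measure_ne_top _ _)
    _ ≤ _ := measureReal_biUnion_finset_le _ _
    _ ≤ (s ×ˢ s').card • Real.exp (-(3 * (m + n))) := sum_le_card_nsmul _ _ _ hz
    _ ≤ Real.exp 2 ^ (m + n) * Real.exp (-(3 * (m + n))) := by
      rw [nsmul_eq_mul]
      refine mul_le_mul_of_nonneg_right ?_ (Real.exp_pos _).le
      have : (s ×ˢ s').card ≤ 5 ^ (m + n) := by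
        rw [card_product, pow_add]; exact Nat.mul_le_mul hcard hcard'
      calc ((s ×ˢ s').card : ℝ) ≤ (5 : ℝ) ^ (m + n) := by exact_mod_cast this
        _ ≤ _ := by gcongr
    _ = _ := by
      rw [← Real.exp_nat_mul, ← Real.exp_add]
      congr 1
      push_cast
      ring

/-! ### The high-probability bound. -/

/-- The scaling of a random matrix is close to the scaling of its expectation with probability at
least `1 - 5 / n`. -/
lemma measureReal_opNorm_scaledMatrix_sub_le [IsProbabilityMeasure μ]
    (hmeas : ∀ i j, Measurable fun ω => A ω i j)
    (hindep : iIndepFun (fun (p : Fin m × Fin n) (ω : Ω) => A ω p.1 p.2) μ)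
    (ha : 0 < a) (hab : ∀ i j, ∀ᵐ ω ∂μ, A ω i j ∈ Set.Icc a b)
    {r : Fin m → ℝ} {c : Fin n → ℝ} (hr : ∀ i, 0 < r i) (hc : ∀ j, 0 < c j)
    (hrc : ∑ i, r i = ∑ j, c j) (hm : 0 < m) (hn : 3 ≤ n) :
    μ.real {ω | opNorm (scaledMatrix (A ω) r c - scaledMatrix (expectedMatrix μ A) r c) ≤
      (36 * (b / a) ^ 5 + 20 * (b / a) ^ 2) * (rho1 r c * rho2 r c * rho3 r c *
        √(Real.log (max (m : ℝ) (n : ℝ))))}ᶜ ≤ 5 / n := by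
  have : Nonempty (Fin m) := ⟨⟨0, hm⟩⟩
  have : Nonempty (Fin n) := ⟨⟨0, by omega⟩⟩
  have hE := expectedMatrix_mem_Icc hmeas hab
  have hle : a ≤ b := (hE ⟨0, hm⟩ ⟨0, by omega⟩).1.trans (hE ⟨0, hm⟩ ⟨0, by omega⟩).2
  have hb : 0 < b := ha.trans_le hle
  have hall : ∀ᵐ ω ∂μ, ∀ i j, A ω i j ∈ Set.Icc a b :=
    ae_all_iff.2 fun i => ae_all_iff.2 fun j => hab i j
  obtain ⟨x, y, hxy, hP⟩ := isScaledMatrix_scaledMatrix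
    (existsUnique_isScaledMatrix ha hE hr hc hrc).exists
  set L : ℝ := max (m : ℝ) (n : ℝ) with hL_def
  have hmL : (m : ℝ) ≤ L := le_max_left _ _
  have hnL : (n : ℝ) ≤ L := le_max_right _ _
  have hn3 : (3 : ℝ) ≤ n := by exact_mod_cast hn
  have hL : 0 < L := by linarith
  -- Here `3 ≤ n` is used, through `exp 1 < 3`; it gives the `1 ≤ t` required by the deterministic
  -- comparison.
  have hlog : 1 ≤ Real.log L := by
    rw [Real.le_log_iff_exp_le hL]
    linarith [Real.exp_one_lt_d9]
  set t := √(Real.log L) with ht_def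
  have ht2 : t ^ 2 = Real.log L := Real.sq_sqrt (by linarith)
  have ht : 1 ≤ t := Real.one_le_sqrt.2 hlog
  -- The factor `2` in the threshold makes each tail `L⁻²`, so a union over at most `L` rows or
  -- columns still costs only `2 / L`.
  have hexp : ∀ {k : ℕ} [Nonempty (Fin k)] (z : Fin k → ℝ), (∀ i, 0 < z i) →
      Real.exp (-(2 * b * norm2 z * t) ^ 2 / (2 * (b ^ 2 * norm2 z ^ 2))) = (L ^ 2)⁻¹ := by
    intro k _ z hz
    have hz0 : 0 < norm2 z ^ 2 := by
      rw [norm2_sq]; exact sum_pos (fun i _ => pow_pos (hz i) 2) univ_nonempty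
    have hz1 : norm2 z ≠ 0 := fun h => by simp [h] at hz0
    have : -(2 * b * norm2 z * t) ^ 2 / (2 * (b ^ 2 * norm2 z ^ 2)) = -(2 * Real.log L) := by
      rw [← ht2]; field_simp
    rw [this, Real.exp_neg, ← Real.exp_log (pow_pos hL 2), Real.log_pow]
    norm_num
  set Rb : Fin m → Set Ω := fun i =>
    {ω | 2 * b * norm2 y * t ≤ |∑ j, (A ω i j - expectedMatrix μ A i j) * y j|} with hRb
  set Cb : Fin n → Set Ω := fun j =>
    {ω | 2 * b * norm2 x * t ≤ |∑ i, (A ω i j - expectedMatrix μ A i j) * x i|} with hCb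
  have hR : ∀ i, μ.real (Rb i) ≤ 2 * (L ^ 2)⁻¹ := fun i => by
    have := measureReal_le_abs_sum_le (μ := μ) hmeas hindep ha.le hle hab
      (fun p => if p.1 = i then y p.2 else 0) (W := norm2 y ^ 2) (t := 2 * b * norm2 y * t)
      (by rw [norm2_sq, Fintype.sum_prod_type]; simp [ite_pow]) (by
        have := norm2_nonneg y; positivity)
    rw [hexp y hxy.2.1] at this
    refine (le_of_eq ?_).trans this
    congr 1
    ext ω
    simp only [hRb, Set.mem_ofPred, Fintype.sum_prod_type]
    simp [mul_comm]
  have hC : ∀ j, μ.real (Cb j) ≤ 2 * (L ^ 2)⁻¹ := fun j => by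
    have := measureReal_le_abs_sum_le (μ := μ) hmeas hindep ha.le hle hab
      (fun p => if p.2 = j then x p.1 else 0) (W := norm2 x ^ 2) (t := 2 * b * norm2 x * t)
      (by rw [norm2_sq, Fintype.sum_prod_type]; simp [ite_pow]) (by
        have := norm2_nonneg x; positivity)
    rw [hexp x hxy.1] at this
    refine (le_of_eq ?_).trans this
    congr 1
    ext ω
    simp only [hCb, Set.mem_ofPred, Fintype.sum_prod_type]
    simp [mul_comm]
  set O : Set Ω := {ω | 10 * b * √(m + n) < opNorm (A ω - expectedMatrix μ A)}
  have hO : μ.real O ≤ 1 / n := by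
    refine (measureReal_opNorm_sub_gt_le hmeas hindep ha hle hab).trans ?_
    rw [Real.exp_neg, ← one_div]
    refine one_div_le_one_div_of_le (by linarith) ?_
    have := Real.add_one_le_exp ((m : ℝ) + n)
    have : (0 : ℝ) ≤ m := by positivity
    linarith
  set Z : Set Ω := {ω | ∀ i j, A ω i j ∈ Set.Icc a b}ᶜ
  have hZ : μ.real Z = 0 := by
    rw [measureReal_def]
    have : μ Z = 0 := hall
    simp [this]
  have hsub : {ω | opNorm (scaledMatrix (A ω) r c - scaledMatrix (expectedMatrix μ A) r c) ≤
      (36 * (b / a) ^ 5 + 20 * (b / a) ^ 2) * (rho1 r c * rho2 r c * rho3 r c * t)}ᶜ ⊆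
      Z ∪ ((⋃ i, Rb i) ∪ ((⋃ j, Cb j) ∪ O)) := by
    intro ω hω
    by_contra hcon
    simp only [Set.mem_union, Set.mem_iUnion, not_or, not_exists] at hcon
    obtain ⟨h1, h2, h3, h4⟩ := hcon
    have hAω : ∀ i j, A ω i j ∈ Set.Icc a b := not_not.1 h1
    refine hω ?_
    change opNorm _ ≤ _
    rw [hP]
    exact hxy.opNorm_sub_le ha ht hE hAω hr hc hrc
      (isScaledMatrix_scaledMatrix (existsUnique_isScaledMatrix ha hAω hr hc hrc).exists)
      (fun i => (not_le.1 (h2 i)).le) (fun j => (not_le.1 (h3 j)).le) (not_lt.1 h4)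
  have hRs : μ.real (⋃ i, Rb i) ≤ 2 / L := by
    refine (measureReal_iUnion_fintype_le _).trans ((sum_le_sum fun i _ => hR i).trans ?_)
    rw [sum_const, card_univ, Fintype.card_fin, nsmul_eq_mul]
    calc (m : ℝ) * (2 * (L ^ 2)⁻¹) ≤ L * (2 * (L ^ 2)⁻¹) := by gcongr
      _ = _ := by field_simp
  have hCs : μ.real (⋃ j, Cb j) ≤ 2 / L := by
    refine (measureReal_iUnion_fintype_le _).trans ((sum_le_sum fun i _ => hC i).trans ?_)
    rw [sum_const, card_univ, Fintype.card_fin, nsmul_eq_mul]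
    calc (n : ℝ) * (2 * (L ^ 2)⁻¹) ≤ L * (2 * (L ^ 2)⁻¹) := by gcongr
      _ = _ := by field_simp
  have hLn : 2 / L ≤ 2 / (n : ℝ) := by gcongr
  have u1 := measureReal_union_le (μ := μ) Z ((⋃ i, Rb i) ∪ ((⋃ j, Cb j) ∪ O))
  have u2 := measureReal_union_le (μ := μ) (⋃ i, Rb i) ((⋃ j, Cb j) ∪ O)
  have u3 := measureReal_union_le (μ := μ) (⋃ j, Cb j) O
  have u0 := measureReal_mono (μ := μ) hsub
  have e : (5 : ℝ) / n = 2 / n + 2 / n + 1 / n := by ring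
  rw [e]
  linarith

/-- Only subadditivity on a set and its complement is used, so the event, which involves a chosen
`scaledMatrix`, need not be shown measurable. -/
lemma isBigOWhp_of_measureReal_compl_le {Ω : ℕ → Type*} [∀ N, MeasurableSpace (Ω N)]
    {μ : ∀ N, Measure (Ω N)} [∀ N, IsProbabilityMeasure (μ N)] {X : ∀ N, Ω N → ℝ} {γ : ℕ → ℝ}
    (C : ℝ) {δ : ℕ → ℝ} (hδ : Tendsto δ atTop (𝓝 0))
    (h : ∀ᶠ N in atTop, (μ N).real {ω | X N ω ≤ C * γ N}ᶜ ≤ δ N) : IsBigOWhp μ X γ := by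
  refine ⟨C, ?_⟩
  have hlim : Tendsto (fun N => 1 - ENNReal.ofReal (δ N)) atTop (𝓝 1) := by
    have h1 := ENNReal.tendsto_ofReal hδ
    rw [ENNReal.ofReal_zero] at h1
    have := ENNReal.Tendsto.sub (tendsto_const_nhds (x := (1 : ENNReal))) h1 (by simp)
    simpa using this
  refine tendsto_of_tendsto_of_tendsto_of_le_of_le' hlim tendsto_const_nhds ?_
    (Eventually.of_forall fun N => prob_le_one)
  filter_upwards [h] with N hN
  rw [tsub_le_iff_right]
  calc (1 : ENNReal) = μ N Set.univ := measure_univ.symm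
    _ ≤ μ N {ω | X N ω ≤ C * γ N} + μ N {ω | X N ω ≤ C * γ N}ᶜ := by
      rw [← Set.union_compl_self {ω | X N ω ≤ C * γ N}]
      exact measure_union_le _ _
    _ ≤ _ := by
      gcongr
      rw [← ofReal_measureReal]
      exact ENNReal.ofReal_le_ofReal hN

/-- Here `ρ₁ = 1 / √n` and `ρ₂ = ρ₃ = 1`. -/
lemma rho_mul_sqrt_log_of_eq_one {r : Fin m → ℝ} {c : Fin n → ℝ} (hmn : m = n) (hn : 0 < n)
    (hr : ∀ i, r i = 1) (hc : ∀ j, c j = 1) :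
    rho1 r c * rho2 r c * rho3 r c * √(Real.log (max (m : ℝ) (n : ℝ))) =
      √(Real.log n / n) := by
  subst hmn
  obtain rfl : r = fun _ => 1 := funext hr
  obtain rfl : c = fun _ => 1 := funext hc
  have : Nonempty (Fin m) := ⟨⟨0, hn⟩⟩
  have hm : (0 : ℝ) < m := by exact_mod_cast hn
  have h1 : rho1 (fun _ : Fin m => (1 : ℝ)) (fun _ : Fin m => (1 : ℝ)) = 1 / √m := by
    simp [rho1, norm2_const, Real.sqrt_div_self']
  have h2 : rho2 (fun _ : Fin m => (1 : ℝ)) (fun _ : Fin m => (1 : ℝ)) = 1 := by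
    simp [rho2, hm.ne']
  have h3 : rho3 (fun _ : Fin m => (1 : ℝ)) (fun _ : Fin m => (1 : ℝ)) = 1 := by
    simp [rho3, hm.ne']
  rw [h1, h2, h3, max_self, Real.sqrt_div' _ hm.le]
  ring

end MatrixScaling

open MatrixScaling MeasureTheory ProbabilityTheory Filter in
theorem mainTheorem3
    {Ω : ℕ → Type*} [∀ N, MeasurableSpace (Ω N)]
    (μ : ∀ N, Measure (Ω N)) [∀ N, IsProbabilityMeasure (μ N)]
    (N₀ : ℕ) (M : ℕ → ℕ) (hM : Tendsto M atTop atTop)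
    (A' : ∀ N, Ω N → Matrix (Fin (M N)) (Fin N) ℝ)
    (r : ∀ N, Fin (M N) → ℝ) (c : ∀ N, Fin N → ℝ)
    (hr : ∀ N ≥ N₀, ∀ i, 0 < r N i) (hc : ∀ N ≥ N₀, ∀ j, 0 < c N j)
    (hrc : ∀ N ≥ N₀, ∑ i, r N i = ∑ j, c N j)
    (hmeas : ∀ N ≥ N₀, ∀ i j, Measurable fun ω => A' N ω i j)
    (hindep : ∀ N ≥ N₀,
      iIndepFun (fun (p : Fin (M N) × Fin N) (ω : Ω N) => A' N ω p.1 p.2) (μ N))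
    (a b : ℝ) (ha : 0 < a)
    (hab : ∀ N ≥ N₀, ∀ i j, ∀ᵐ ω ∂μ N, A' N ω i j ∈ Set.Icc a b) :
    -- the scaled matrices `P^(N)` and (almost surely) `P'^(N)` exist and are unique
    (∀ N ≥ N₀,
      (∃! P, IsScaledMatrix (expectedMatrix (μ N) (A' N)) (r N) (c N) P) ∧
      ∀ᵐ ω ∂μ N, ∃! P, IsScaledMatrix (A' N ω) (r N) (c N) P) ∧
    IsBigOWhp μ
      (fun N ω => opNorm (scaledMatrix (A' N ω) (r N) (c N) -
        scaledMatrix (expectedMatrix (μ N) (A' N)) (r N) (c N)))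
      (fun N => rho1 (r N) (c N) * rho2 (r N) (c N) * rho3 (r N) (c N) *
        √(Real.log (max (M N : ℝ) (N : ℝ)))) ∧
    -- doubly-stochastic scaling
    ((∀ N ≥ N₀, M N = N ∧ (∀ i, r N i = 1) ∧ ∀ j, c N j = 1) →
      IsBigOWhp μ
        (fun N ω => opNorm (scaledMatrix (A' N ω) (r N) (c N) -
          scaledMatrix (expectedMatrix (μ N) (A' N)) (r N) (c N)))
        (fun N => √(Real.log N / N))) := by
  have hlim : Tendsto (fun N : ℕ => (5 : ℝ) / N) atTop (nhds 0) :=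
    tendsto_const_div_atTop_nhds_zero_nat 5
  refine ⟨fun N hN => ⟨?_, ?_⟩, ?_, fun hds => ?_⟩
  · exact existsUnique_isScaledMatrix ha (expectedMatrix_mem_Icc (hmeas N hN) (hab N hN))
      (hr N hN) (hc N hN) (hrc N hN)
  · have hall : ∀ᵐ ω ∂μ N, ∀ i j, A' N ω i j ∈ Set.Icc a b :=
      ae_all_iff.2 fun i => ae_all_iff.2 fun j => hab N hN i j
    filter_upwards [hall] with ω hω
    exact existsUnique_isScaledMatrix ha hω (hr N hN) (hc N hN) (hrc N hN)
  · refine isBigOWhp_of_measureReal_compl_le (36 * (b / a) ^ 5 + 20 * (b / a) ^ 2) hlim ?_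
    filter_upwards [eventually_ge_atTop N₀, eventually_ge_atTop 3, hM.eventually_gt_atTop 0]
      with N hN hN3 hMN
    exact measureReal_opNorm_scaledMatrix_sub_le (hmeas N hN) (hindep N hN) ha (hab N hN)
      (hr N hN) (hc N hN) (hrc N hN) hMN hN3
  · refine isBigOWhp_of_measureReal_compl_le (36 * (b / a) ^ 5 + 20 * (b / a) ^ 2) hlim ?_
    filter_upwards [eventually_ge_atTop N₀, eventually_ge_atTop 3, hM.eventually_gt_atTop 0]
      with N hN hN3 hMN
    obtain ⟨hMN', hr1, hc1⟩ := hds N hN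
    rw [← rho_mul_sqrt_log_of_eq_one hMN' (by omega) hr1 hc1]
    exact measureReal_opNorm_scaledMatrix_sub_le (hmeas N hN) (hindep N hN) ha (hab N hN)
      (hr N hN) (hc N hN) (hrc N hN) hMN hN3
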